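/- Let $TH_4(n)$, $n\ge 0$, be the four-dimensional Tower of Hanoi graphs: $TH_4(0)$ is the complete graph on five vertices, all of which are its outmost vertices, numbered $0,\dots,4$; $TH_4(n+1)$ consists of five copies of $TH_4(n)$, numbered $0,\dots,4$, together with, for each pair $i\ne j$, one edge joining the $j$-th outmost vertex of copy $i$ to the $i$-th outmost vertex of copy $j$, and its $i$-th outmost vertex is the $i$-th outmost vertex of copy $i$. Thus $TH_4(n)$ has $v(TH_4(n))=5^{n+1}$ vertices. A dimer-monomer configuration is a matching (a set of pairwise disjoint edges); a vertex is covered by a dimer if it lies on an edge of the matching, and by a monomer otherwise. Let $N_{DM}(TH_4(n))$ be the number of matchings of $TH_4(n)$, and let $f_4(n)$, $g_4(n)$, $s_4(n)$, $u_4(n)$ be the number of matchings for which, respectively: all five outmost vertices are covered by monomers; one fixed outmost vertex is covered by a dimer and the other four by monomers; one fixed outmost vertex is covered by a monomer and the other four by dimers; all five outmost vertices are covered by dimers. (By symmetry the choice of the fixed vertex does not matter.) Put $\alpha_4(n)=f_4(n)/g_4(n)$ and $\omega_4(n)=s_4(n)/u_4(n)$. Then the entropy per site $$z_{TH_4}=\lim_{n\to\infty}\frac{\ln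 N_{DM}(TH_4(n))}{v(TH_4(n))}$$ exists, and for every positive integer $k$ one has $g_4(k)>0$, $u_4(k)>0$ and $$\frac{\ln u_4(k)}{5^{k+1}}+\frac{\ln\left[1+2\omega_4(k)+2\omega_4(k)^2\right]}{2\cdot 5^{k}}<z_{TH_4}<\frac{\ln u_4(k)}{5^{k+1}}+\frac{\ln\left[1+2\alpha_4(k)+2\alpha_4(k)^2\right]}{2\cdot 5^{k}}.$$ -/

import Mathlib

open Filter Topology

namespace TowerOfHanoi

/-- The vertices of the `d`-dimensional Tower of Hanoi graph at stage `n`: `d + 1` vertices at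
stage `0`, and `d + 1` copies of the vertices of stage `n` at stage `n + 1`. -/
def Vert (d : ℕ) : ℕ → Type
  | 0 => Fin (d + 1)
  | n + 1 => Fin (d + 1) × Vert d n

/-- The `d + 1` outmost vertices: at stage `n + 1` the `i`-th one is the `i`-th outmost vertex of
the `i`-th copy of stage `n`. -/
def corner (d : ℕ) : (n : ℕ) → Fin (d + 1) → Vert d n
  | 0, i => i
  | n + 1, i => (i, corner d n i)

/-- Adjacency: the complete graph at stage `0`; stage `n + 1` consists of `d + 1` copies of
stage `n` and one extra edge for each pair `i ≠ j` of copies, which joins the `j`-th outmost vertex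
of copy `i` to the `i`-th outmost vertex of copy `j`. -/
def Adjacent (d : ℕ) : (n : ℕ) → Vert d n → Vert d n → Prop
  | 0, x, y => x ≠ y
  | n + 1, (i, x), (j, y) =>
      (i = j ∧ Adjacent d n x y) ∨ (i ≠ j ∧ x = corner d n j ∧ y = corner d n i)

theorem adjacent_symm (d : ℕ) : ∀ (n : ℕ) (x y : Vert d n), Adjacent d n x y → Adjacent d n y x
  | 0, _, _, h => Ne.symm h
  | n + 1, (_, x), (_, y), h => h.elim
      (fun h => Or.inl ⟨h.1.symm, adjacent_symm d n x y h.2⟩)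
      (fun h => Or.inr ⟨h.1.symm, h.2.2, h.2.1⟩)

theorem adjacent_irrefl (d : ℕ) : ∀ (n : ℕ) (x : Vert d n), ¬ Adjacent d n x x
  | 0, _, h => h rfl
  | n + 1, (_, x), h => h.elim (fun h => adjacent_irrefl d n x h.2) (fun h => h.1 rfl)

/-- The `d`-dimensional Tower of Hanoi graph `TH_d(n)` at stage `n`. -/
def TH (d n : ℕ) : SimpleGraph (Vert d n) where
  Adj := Adjacent d n
  symm := ⟨adjacent_symm d n⟩
  loopless := ⟨adjacent_irrefl d n⟩

instance instFiniteVert (d : ℕ) : ∀ n : ℕ, Finite (Vert d n)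
  | 0 => inferInstanceAs (Finite (Fin (d + 1)))
  | n + 1 =>
    haveI := instFiniteVert d n
    inferInstanceAs (Finite (Fin (d + 1) × Vert d n))

/-- The number `N_DM(G)` of matchings (dimer-monomer configurations) of a graph. The vertices of
the subgraph `m` are those covered by dimers, all others are covered by monomers. -/
noncomputable def numDimerMonomers {V : Type*} (G : SimpleGraph V) : ℕ :=
  Nat.card {m : G.Subgraph // m.IsMatching}

/-- The number of matchings of `TH_d(n)` for which exactly the outmost vertices with index in `S`
are covered by dimers, the other outmost vertices being covered by monomers. -/
noncomputable def numWithDimersAt (d n : ℕ) (S : Set (Fin (d + 1))) : ℕ :=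
  Nat.card {m : (TH d n).Subgraph // m.IsMatching ∧ ∀ i, corner d n i ∈ m.verts ↔ i ∈ S}

/-- `f_4(n)`: all five outmost vertices are covered by monomers. -/
noncomputable def f₄ (n : ℕ) : ℕ := numWithDimersAt 4 n ∅

/-- `g_4(n)`: one certain outmost vertex is covered by a dimer, the other four by monomers. -/
noncomputable def g₄ (n : ℕ) : ℕ := numWithDimersAt 4 n {0}

/-- `s_4(n)`: one certain outmost vertex is covered by a monomer, the other four by dimers. -/
noncomputable def s₄ (n : ℕ) : ℕ := numWithDimersAt 4 n {0}ᶜ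

/-- `u_4(n)`: all five outmost vertices are covered by dimers. -/
noncomputable def u₄ (n : ℕ) : ℕ := numWithDimersAt 4 n Set.univ

/-- `α_4(n) = f_4(n) / g_4(n)`. -/
noncomputable def α₄ (n : ℕ) : ℝ := (f₄ n : ℝ) / (g₄ n : ℝ)

/-- `ω_4(n) = s_4(n) / u_4(n)`. -/
noncomputable def ω₄ (n : ℕ) : ℝ := (s₄ n : ℝ) / (u₄ n : ℝ)

/-- `z` is the entropy per site `z_{TH_d}`, the limit of `ln N_DM(TH_d(n)) / v(TH_d(n))`. -/
def IsEntropyPerSite (d : ℕ) (z : ℝ) : Prop :=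
  Tendsto (fun n : ℕ => Real.log (numDimerMonomers (TH d n) : ℝ) / (Nat.card (Vert d n) : ℝ))
    atTop (𝓝 z)

end TowerOfHanoi

/-!
Matchings are encoded as involutions of the vertex set that move every vertex to itself or along an
edge. By symmetry the number of matchings of `TH_d(n)` covering exactly a given set of outmost
vertices depends only on the size `k` of that set; call it `a_n(k)` (`cornerCount d n k`). A
matching of `TH_d(n + 1)` consists of a set `H` of connecting edges, that is, a simple graph on the
`d + 1` copies, and of matchings of the copies that leave the ends of these edges alone, so that
(`numWithDimersAt_succ`) `a_{n+1}` is a sum over all `H` of a product over the copies `i`, whose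
factors depend on `a_n`, on the degree of `i` in `H` and on the prescribed status of the own outmost
vertex of the copy.

The key fact is that `a_n` is log-convex for `n ≥ 1`, so that all quotients `a_n(k) / a_n(k + 1)`
lie between `ω₄ n`, the last one, and `α₄ n`, the first one. For `n = 1` this is a computation.
The passage from `n` to `n + 1` (`step_erase_mul_step_erase_le`) is an application of the four
functions theorem on the distributive lattice of simple graphs on the copies: vertex degrees are
modular on this lattice, and log-convexity of `a_n` gives the lattice condition for every factor
separately.

The recursion turns bounds on the quotients of `a_n` into the same bounds on those of `a_{n+1}`,
hence `ω₄` increases and `α₄` decreases. Replacing `a_n` by the geometric sequence with quotient `x`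
and last term `u₄ n` turns the recursion for `u₄ (n + 1)` into
`u₄ n ^ 5 * (1 + 2 * x + 2 * x ^ 2) ^ 10` (`sum_prod_geometric`), because by the handshake lemma
each of the ten pairs of copies contributes `x ^ 2 + (1 + x) ^ 2`. So this is a lower bound of
`u₄ (n + 1)` for `x = ω₄ n` and an upper bound for `x = α₄ n`, and both are strict because `a_n` is
never geometric: `a_n(1) * a_n(3)` and `a_n(2) ^ 2` differ modulo `3` (`cornerCount_mul_ne_sq`).
Consequently the two bounds of the theorem are strictly monotone in the stage when `x` is
frozen at stage `k`, and they squeeze the limit (`strictMono_entropyBound`,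
`strictAnti_entropyBound`).
-/

namespace TowerOfHanoi

/-! ### Matchings as involutions -/

/-- An involution of the vertices that moves every vertex to itself or along an edge. Such maps
encode the matchings of `G`: a vertex is covered by a dimer iff it is moved. -/
def IsPairing {V : Type*} (G : SimpleGraph V) (φ : V → V) : Prop :=
  (∀ x, φ (φ x) = x) ∧ ∀ x, φ x ≠ x → G.Adj x (φ x)

/-- The matching whose edges join the moved vertices of a pairing to their images. -/
def IsPairing.toSubgraph {V : Type*} {G : SimpleGraph V} {φ : V → V} (h : IsPairing G φ) :
    G.Subgraph where
  verts := {x | φ x ≠ x}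
  Adj x y := φ x = y ∧ x ≠ y
  adj_sub := by
    rintro x y ⟨rfl, hne⟩
    exact h.2 x hne.symm
  edge_vert := by
    rintro x y ⟨rfl, hne⟩
    exact hne.symm
  symm := ⟨by
    rintro x y ⟨rfl, hne⟩
    exact ⟨h.1 x, hne.symm⟩⟩

theorem IsPairing.isMatching_toSubgraph {V : Type*} {G : SimpleGraph V} {φ : V → V}
    (h : IsPairing G φ) : h.toSubgraph.IsMatching := by
  intro x hx
  exact ⟨φ x, ⟨rfl, fun e => hx e.symm⟩, fun y hy => hy.1.symm⟩

theorem exists_pairing_of_isMatching {V : Type*} {G : SimpleGraph V} (m : G.Subgraph)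
    (hm : m.IsMatching) : ∃ (φ : V → V) (h : IsPairing G φ), h.toSubgraph = m := by
  classical
  choose f hf hu using fun (x : V) (hx : x ∈ m.verts) => hm hx
  have hv : ∀ x hx, f x hx ∈ m.verts := fun x hx => m.edge_vert (hf x hx).symm
  let φ : V → V := fun x => if hx : x ∈ m.verts then f x hx else x
  have e1 : ∀ x (hx : x ∈ m.verts), φ x = f x hx := fun x hx => dif_pos hx
  have e2 : ∀ x, x ∉ m.verts → φ x = x := fun x hx => dif_neg hx
  have hP : IsPairing G φ := by
    refine ⟨fun x => ?_, fun x hx => ?_⟩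
    · by_cases h : x ∈ m.verts
      · rw [e1 x h, e1 _ (hv x h)]
        exact (hu _ (hv x h) x (hf x h).symm).symm
      · rw [e2 x h, e2 x h]
    · by_cases h : x ∈ m.verts
      · rw [e1 x h]
        exact m.adj_sub (hf x h)
      · exact absurd (e2 x h) hx
  refine ⟨φ, hP, ?_⟩
  ext x y
  · change φ x ≠ x ↔ x ∈ m.verts
    constructor
    · intro h
      by_contra h'
      exact h (e2 x h')
    · intro h e
      rw [e1 x h] at e
      have := m.adj_sub (hf x h)
      rw [e] at this
      exact G.loopless.irrefl x this
  · change (φ x = y ∧ x ≠ y) ↔ m.Adj x y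
    constructor
    · rintro ⟨rfl, hne⟩
      by_cases h : x ∈ m.verts
      · rw [e1 x h]
        exact hf x h
      · exact absurd (e2 x h).symm hne
    · intro h
      have hx := m.edge_vert h
      refine ⟨?_, (m.adj_sub h).ne⟩
      rw [e1 x hx]
      exact (hu x hx y h).symm

/-- Matchings with a prescribed property of the covered vertices are as numerous as pairings with
that property of the moved vertices. -/
theorem card_matchings_eq_card_pairings {V : Type*} (G : SimpleGraph V) (P : Set V → Prop) :
    Nat.card {m : G.Subgraph // m.IsMatching ∧ P m.verts} =
      Nat.card {φ : V → V // IsPairing G φ ∧ P {x | φ x ≠ x}} := by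
  symm
  refine Nat.card_congr (Equiv.ofBijective
    (fun φ => ⟨φ.2.1.toSubgraph, φ.2.1.isMatching_toSubgraph, φ.2.2⟩) ⟨?_, ?_⟩)
  · rintro ⟨φ, hφ, h1⟩ ⟨ψ, hψ, h2⟩ h
    have h := congrArg (fun m => m.1.Adj) h
    apply Subtype.ext
    funext x
    have hx : ∀ y, (φ x = y ∧ x ≠ y) ↔ (ψ x = y ∧ x ≠ y) := fun y => iff_of_eq (congrFun₂ h x y)
    change φ x = ψ x
    by_cases e : φ x = x
    · by_contra hne
      rw [e] at hne
      exact hne (((hx (ψ x)).2 ⟨rfl, hne⟩).1 ▸ e).symm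
    · exact ((hx (φ x)).1 ⟨rfl, fun e' => e e'.symm⟩).1.symm
  · rintro ⟨m, hm, h⟩
    obtain ⟨φ, hφ, rfl⟩ := exists_pairing_of_isMatching m hm
    exact ⟨⟨φ, hφ, h⟩, rfl⟩

/-! ### Outmost vertices and their symmetry -/

theorem corner_injective (d : ℕ) : ∀ n, Function.Injective (corner d n)
  | 0 => fun _ _ h => h
  | _ + 1 => fun _ _ h => congrArg Prod.fst h

theorem card_vert (d : ℕ) : ∀ n, Nat.card (Vert d n) = (d + 1) ^ (n + 1)
  | 0 => by
    change Nat.card (Fin (d + 1)) = _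
    simp
  | n + 1 => by
    change Nat.card (Fin (d + 1) × Vert d n) = _
    rw [Nat.card_prod, card_vert d n, Nat.card_eq_fintype_card, Fintype.card_fin]
    ring

/-- The number of pairings of `TH_d(n)` that fix the outmost vertices with index in `U` and move
those with index in `M`. -/
noncomputable def numPairings (d n : ℕ) (U M : Finset (Fin (d + 1))) : ℕ :=
  Nat.card {φ : Vert d n → Vert d n // IsPairing (TH d n) φ ∧
    (∀ i ∈ U, φ (corner d n i) = corner d n i) ∧ ∀ i ∈ M, φ (corner d n i) ≠ corner d n i}

theorem numWithDimersAt_eq (d n : ℕ) (S : Finset (Fin (d + 1))) :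
    numWithDimersAt d n S = numPairings d n Sᶜ S := by
  unfold numWithDimersAt numPairings
  rw [card_matchings_eq_card_pairings (TH d n) (fun A => ∀ i, corner d n i ∈ A ↔ i ∈ (S : Set _))]
  refine Nat.card_congr (Equiv.subtypeEquivRight fun φ => and_congr_right fun _ => ?_)
  constructor
  · intro h
    refine ⟨fun i hi => ?_, fun i hi => (h i).2 hi⟩
    by_contra hne
    exact (Finset.mem_compl.1 hi) ((h i).1 hne)
  · rintro ⟨h1, h2⟩ i
    refine ⟨fun hne => ?_, fun hi => h2 i hi⟩
    by_contra hi
    exact hne (h1 i (Finset.mem_compl.2 hi))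

theorem numDimerMonomers_eq (d n : ℕ) : numDimerMonomers (TH d n) = numPairings d n ∅ ∅ := by
  have h := card_matchings_eq_card_pairings (TH d n) (fun _ => True)
  simpa [numDimerMonomers, numPairings] using h

/-- A free outmost vertex is either fixed or moved. -/
theorem numPairings_insert (d n : ℕ) (U M : Finset (Fin (d + 1))) (j : Fin (d + 1)) :
    numPairings d n U M = numPairings d n (insert j U) M + numPairings d n U (insert j M) := by
  classical
  unfold numPairings
  rw [← Nat.card_sum]
  refine Nat.card_congr ?_
  refine ((Equiv.sumCompl (fun φ : {φ : Vert d n → Vert d n // IsPairing (TH d n) φ ∧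
    (∀ i ∈ U, φ (corner d n i) = corner d n i) ∧ ∀ i ∈ M, φ (corner d n i) ≠ corner d n i} =>
      φ.1 (corner d n j) = corner d n j)).symm).trans (Equiv.sumCongr ?_ ?_)
  · refine (Equiv.subtypeSubtypeEquivSubtypeInter _
      (fun φ : Vert d n → Vert d n => φ (corner d n j) = corner d n j)).trans
      (Equiv.subtypeEquivRight fun φ => ?_)
    rw [Finset.forall_mem_insert]
    tauto
  · refine (Equiv.subtypeSubtypeEquivSubtypeInter _
      (fun φ : Vert d n → Vert d n => ¬ φ (corner d n j) = corner d n j)).trans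
      (Equiv.subtypeEquivRight fun φ => ?_)
    rw [Finset.forall_mem_insert]
    tauto

/-- The automorphism of `TH_d(n)` induced by a permutation of the outmost vertices. -/
def vertPerm (d : ℕ) (σ : Equiv.Perm (Fin (d + 1))) : (n : ℕ) → Equiv.Perm (Vert d n)
  | 0 => σ
  | n + 1 => Equiv.prodCongr σ (vertPerm d σ n)

theorem vertPerm_corner (d : ℕ) (σ : Equiv.Perm (Fin (d + 1))) :
    ∀ n i, vertPerm d σ n (corner d n i) = corner d n (σ i)
  | 0, _ => rfl
  | n + 1, i => Prod.ext rfl (vertPerm_corner d σ n i)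

theorem adjacent_vertPerm (d : ℕ) (σ : Equiv.Perm (Fin (d + 1))) :
    ∀ n x y, Adjacent d n x y → Adjacent d n (vertPerm d σ n x) (vertPerm d σ n y)
  | 0, x, y, h => fun e => h (σ.injective e)
  | n + 1, (i, x), (j, y), h => by
    rcases h with ⟨rfl, h⟩ | ⟨hne, rfl, rfl⟩
    · exact Or.inl ⟨rfl, adjacent_vertPerm d σ n x y h⟩
    · exact Or.inr ⟨fun e => hne (σ.injective e), vertPerm_corner d σ n j, vertPerm_corner d σ n i⟩

theorem numPairings_le_map (d n : ℕ) (σ : Equiv.Perm (Fin (d + 1))) (U M : Finset (Fin (d + 1))) :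
    numPairings d n U M ≤ numPairings d n (U.map σ.toEmbedding) (M.map σ.toEmbedding) := by
  unfold numPairings
  let e := vertPerm d σ n
  have hc : ∀ i, e.symm (corner d n (σ i)) = corner d n i := fun i => by
    rw [Equiv.symm_apply_eq]
    exact (vertPerm_corner d σ n i).symm
  refine Nat.card_le_card_of_injective
    (fun φ => ⟨fun x => e (φ.1 (e.symm x)), ⟨fun x => ?_, fun x hx => ?_⟩, ?_, ?_⟩) ?_
  · simp [φ.2.1.1]
  · have h : φ.1 (e.symm x) ≠ e.symm x := fun h =>
      hx ((congrArg e h).trans (e.apply_symm_apply x))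
    have := adjacent_vertPerm d σ n _ _ (φ.2.1.2 _ h)
    change Adjacent d n (e (e.symm x)) _ at this
    rwa [e.apply_symm_apply] at this
  · intro i hi
    obtain ⟨j, hj, rfl⟩ := Finset.mem_map.1 hi
    change e (φ.1 (e.symm (corner d n (σ j)))) = corner d n (σ j)
    rw [hc, φ.2.2.1 j hj]
    exact vertPerm_corner d σ n j
  · intro i hi
    obtain ⟨j, hj, rfl⟩ := Finset.mem_map.1 hi
    change e (φ.1 (e.symm (corner d n (σ j)))) ≠ corner d n (σ j)
    rw [hc, ← vertPerm_corner d σ n j]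
    exact fun h => φ.2.2.2 j hj (e.injective h)
  · intro φ ψ h
    apply Subtype.ext
    funext x
    have := congrFun (congrArg Subtype.val h) (e x)
    simpa using this

theorem exists_perm_map_eq {α : Type*} [Fintype α] [DecidableEq α] {S T : Finset α}
    (h : S.card = T.card) : ∃ σ : Equiv.Perm α, S.map σ.toEmbedding = T := by
  obtain ⟨e⟩ : Nonempty ({x // x ∈ S} ≃ {x // x ∈ T}) := by
    rw [← Fintype.card_eq]
    simpa using h
  refine ⟨e.extendSubtype, ?_⟩
  refine Finset.eq_of_subset_of_card_le (fun y hy => ?_) (by simp [h])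
  obtain ⟨x, hx, rfl⟩ := Finset.mem_map.1 hy
  exact e.extendSubtype_mem x hx

theorem numPairings_compl_le (d n : ℕ) {S T : Finset (Fin (d + 1))} (h : S.card = T.card) :
    numPairings d n Sᶜ S ≤ numPairings d n Tᶜ T := by
  obtain ⟨σ, rfl⟩ := exists_perm_map_eq h
  refine (numPairings_le_map d n σ Sᶜ S).trans_eq ?_
  congr 1
  ext x
  simp only [Finset.mem_map_equiv, Finset.mem_compl]

/-- The number of matchings of `TH_d(n)` that cover exactly the first `k` outmost vertices; it is
meaningful for `k ≤ d + 1` only. -/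
noncomputable def cornerCount (d n k : ℕ) : ℕ :=
  numWithDimersAt d n ({i : Fin (d + 1) | (i : ℕ) < k} : Finset (Fin (d + 1)))

/-- By symmetry only the number of covered outmost vertices matters. -/
theorem numWithDimersAt_eq_cornerCount (d n : ℕ) (S : Finset (Fin (d + 1))) :
    numWithDimersAt d n S = cornerCount d n S.card := by
  have hS : S.card ≤ d + 1 := by simpa using S.card_le_univ
  have h : S.card = ({i : Fin (d + 1) | (i : ℕ) < S.card} : Finset (Fin (d + 1))).card := by
    rw [Fin.card_filter_val_lt, min_eq_right hS]
  rw [cornerCount, numWithDimersAt_eq, numWithDimersAt_eq]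
  exact le_antisymm (numPairings_compl_le d n h) (numPairings_compl_le d n h.symm)

/-! ### Free outmost vertices -/

/-- The iterated binomial sum `∑ j, r.choose j * a (k + j)`, defined by its Pascal recursion. When
`a` counts matchings by the number of covered outmost vertices, this counts the matchings for
which `k` outmost vertices have to be covered and `r` are left free. -/
def binomSum {R : Type*} [Add R] (a : ℕ → R) : ℕ → ℕ → R
  | 0, k => a k
  | r + 1, k => binomSum a r k + binomSum a r (k + 1)

theorem numPairings_eq_binomSum (d n : ℕ) (r : ℕ) : ∀ (U M : Finset (Fin (d + 1))),
    Disjoint U M → U.card + M.card + r = d + 1 →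
      numPairings d n U M = binomSum (cornerCount d n) r M.card := by
  induction r with
  | zero =>
    intro U M hd hc
    have hU : U = Mᶜ := by
      refine Finset.eq_of_subset_of_card_le
        (fun x hx => Finset.mem_compl.2 (Finset.disjoint_left.1 hd hx)) ?_
      rw [Finset.card_compl, Fintype.card_fin]
      omega
    rw [hU, ← numWithDimersAt_eq, numWithDimersAt_eq_cornerCount]
    rfl
  | succ r ih =>
    intro U M hd hc
    obtain ⟨j, hj⟩ : ∃ j, j ∉ U ∪ M := by
      by_contra! h
      have h1 : U ∪ M = Finset.univ := Finset.eq_univ_of_forall h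
      have h2 := Finset.card_union_of_disjoint hd
      rw [h1, Finset.card_univ, Fintype.card_fin] at h2
      omega
    rw [Finset.mem_union, not_or] at hj
    rw [numPairings_insert d n U M j, binomSum, ih, ih, Finset.card_insert_of_notMem hj.2]
    · exact Finset.disjoint_insert_right.2 ⟨hj.1, hd⟩
    · rw [Finset.card_insert_of_notMem hj.2]
      omega
    · exact Finset.disjoint_insert_left.2 ⟨hj.2, hd⟩
    · rw [Finset.card_insert_of_notMem hj.1]
      omega

/-! ### Decomposition of a matching into the copies -/

/-- In a pairing of `TH_d(n + 1)` a vertex can leave its copy only along a connecting edge. -/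
theorem IsPairing.eq_corner_of_fst_ne {d n : ℕ} {φ : Vert d (n + 1) → Vert d (n + 1)}
    (h : IsPairing (TH d (n + 1)) φ) {i j : Fin (d + 1)} {x y : Vert d n}
    (e : φ (i, x) = (j, y)) (hij : i ≠ j) : x = corner d n j ∧ y = corner d n i := by
  have hne : φ (i, x) ≠ (i, x) := by
    rw [e]
    exact fun e' => hij (congrArg Prod.fst e').symm
  have := h.2 _ hne
  rw [e] at this
  rcases this with ⟨h1, -⟩ | ⟨-, h2⟩
  · exact absurd h1 hij
  · exact h2

/-- A set `H` of connecting edges together with a pairing of each copy of `TH_d(n)` that leaves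
the ends of the edges in `H` alone. -/
def IsDecomposition (d n : ℕ)
    (p : SimpleGraph (Fin (d + 1)) × (Fin (d + 1) → Vert d n → Vert d n)) : Prop :=
  ∀ i, IsPairing (TH d n) (p.2 i) ∧ ∀ j, p.1.Adj i j → p.2 i (corner d n j) = corner d n j

open Classical in
/-- The pairing of `TH_d(n + 1)` assembled from connecting edges and pairings of the copies. -/
noncomputable def glue (d n : ℕ)
    (p : SimpleGraph (Fin (d + 1)) × (Fin (d + 1) → Vert d n → Vert d n)) :
    Vert d (n + 1) → Vert d (n + 1) := fun v =>
  if h : ∃ j, p.1.Adj v.1 j ∧ v.2 = corner d n j then (h.choose, corner d n v.1)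
  else (v.1, p.2 v.1 v.2)

theorem glue_corner {d n : ℕ}
    (p : SimpleGraph (Fin (d + 1)) × (Fin (d + 1) → Vert d n → Vert d n)) {i j : Fin (d + 1)}
    (h : p.1.Adj i j) : glue d n p (i, corner d n j) = (j, corner d n i) := by
  have h' : ∃ k, p.1.Adj i k ∧ corner d n j = corner d n k := ⟨j, h, rfl⟩
  have e : h'.choose = j := (corner_injective d n h'.choose_spec.2).symm
  refine (dif_pos h').trans ?_
  exact Prod.ext e rfl

theorem glue_of_not {d n : ℕ}
    (p : SimpleGraph (Fin (d + 1)) × (Fin (d + 1) → Vert d n → Vert d n)) {i : Fin (d + 1)}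
    {x : Vert d n} (h : ∀ j, p.1.Adj i j → x ≠ corner d n j) :
    glue d n p (i, x) = (i, p.2 i x) :=
  dif_neg fun ⟨j, h1, h2⟩ => h j h1 h2

theorem IsDecomposition.image_ne_corner {d n : ℕ}
    {p : SimpleGraph (Fin (d + 1)) × (Fin (d + 1) → Vert d n → Vert d n)}
    (hp : IsDecomposition d n p) {i : Fin (d + 1)} {x : Vert d n}
    (h : ∀ j, p.1.Adj i j → x ≠ corner d n j) (j : Fin (d + 1)) (hj : p.1.Adj i j) :
    p.2 i x ≠ corner d n j := fun e => h j hj (by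
  rw [← (hp i).1.1 x, e, (hp i).2 j hj])

theorem isPairing_glue {d n : ℕ}
    {p : SimpleGraph (Fin (d + 1)) × (Fin (d + 1) → Vert d n → Vert d n)}
    (hp : IsDecomposition d n p) : IsPairing (TH d (n + 1)) (glue d n p) := by
  refine ⟨fun v => ?_, fun v hv => ?_⟩
  · obtain ⟨i, x⟩ := v
    by_cases h : ∃ j, p.1.Adj i j ∧ x = corner d n j
    · obtain ⟨j, hj, rfl⟩ := h
      rw [glue_corner p hj, glue_corner p hj.symm]
    · have h : ∀ j, p.1.Adj i j → x ≠ corner d n j := fun j h1 h2 => h ⟨j, h1, h2⟩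
      rw [glue_of_not p h, glue_of_not p (hp.image_ne_corner h), (hp i).1.1 x]
  · obtain ⟨i, x⟩ := v
    by_cases h : ∃ j, p.1.Adj i j ∧ x = corner d n j
    · obtain ⟨j, hj, rfl⟩ := h
      rw [glue_corner p hj]
      exact Or.inr ⟨hj.ne, rfl, rfl⟩
    · have h : ∀ j, p.1.Adj i j → x ≠ corner d n j := fun j h1 h2 => h ⟨j, h1, h2⟩
      rw [glue_of_not p h] at hv ⊢
      refine Or.inl ⟨rfl, (hp i).1.2 x fun e => hv ?_⟩
      exact Prod.ext rfl e

theorem glue_corner_eq_iff {d n : ℕ}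
    {p : SimpleGraph (Fin (d + 1)) × (Fin (d + 1) → Vert d n → Vert d n)} {i j : Fin (d + 1)}
    (hij : i ≠ j) : glue d n p (i, corner d n j) = (j, corner d n i) ↔ p.1.Adj i j := by
  refine ⟨fun e => ?_, glue_corner p⟩
  by_contra hn
  have hj : ∀ k, p.1.Adj i k → corner d n j ≠ corner d n k := by
    intro k hk e'
    obtain rfl := corner_injective d n e'
    exact hn hk
  rw [glue_of_not p hj] at e
  exact hij (congrArg Prod.fst e)

theorem glue_injective {d n : ℕ}
    {p q : SimpleGraph (Fin (d + 1)) × (Fin (d + 1) → Vert d n → Vert d n)}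
    (hp : IsDecomposition d n p) (hq : IsDecomposition d n q) (h : glue d n p = glue d n q) :
    p = q := by
  have h1 : p.1 = q.1 := by
    ext i j
    by_cases hij : i = j
    · subst hij
      simp
    · rw [← glue_corner_eq_iff hij, ← glue_corner_eq_iff hij, h]
  refine Prod.ext h1 ?_
  funext i x
  by_cases hx : ∃ j, p.1.Adj i j ∧ x = corner d n j
  · obtain ⟨j, hj, rfl⟩ := hx
    rw [(hp i).2 j hj, (hq i).2 j (h1 ▸ hj)]
  · have hx : ∀ j, p.1.Adj i j → x ≠ corner d n j := fun j h1 h2 => hx ⟨j, h1, h2⟩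
    have e := congrFun h (i, x)
    rw [glue_of_not p hx, glue_of_not q (h1 ▸ hx)] at e
    exact congrArg Prod.snd e

theorem exists_glue_eq {d n : ℕ} {φ : Vert d (n + 1) → Vert d (n + 1)}
    (h : IsPairing (TH d (n + 1)) φ) : ∃ p, IsDecomposition d n p ∧ glue d n p = φ := by
  classical
  let H : SimpleGraph (Fin (d + 1)) :=
    { Adj := fun i j => i ≠ j ∧ φ (i, corner d n j) = (j, corner d n i)
      symm := ⟨fun i j hij => ⟨hij.1.symm, (congrArg φ hij.2).symm.trans (h.1 _)⟩⟩
      loopless := ⟨fun i hi => hi.1 rfl⟩ }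
  let ψ : Fin (d + 1) → Vert d n → Vert d n := fun i x =>
    if (φ (i, x)).1 = i then (φ (i, x)).2 else x
  have inside : ∀ i x, (φ (i, x)).1 = i → φ (i, x) = (i, ψ i x) := fun i x e =>
    Prod.ext e (if_pos e).symm
  have outside : ∀ i x, (φ (i, x)).1 ≠ i → ψ i x = x := fun i x e => if_neg e
  have cross : ∀ i x, (φ (i, x)).1 ≠ i → ∃ j, H.Adj i j ∧ x = corner d n j := by
    intro i x e
    obtain ⟨h1, h2⟩ := h.eq_corner_of_fst_ne (j := (φ (i, x)).1) (y := (φ (i, x)).2) rfl e.symm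
    refine ⟨(φ (i, x)).1, ⟨e.symm, ?_⟩, h1⟩
    rw [← h1, ← h2]
    rfl
  have hp : IsDecomposition d n (H, ψ) := by
    intro i
    refine ⟨⟨fun x => ?_, fun x hx => ?_⟩, fun j hj => ?_⟩
    · by_cases e : (φ (i, x)).1 = i
      · have e1 := inside i x e
        have e2 : φ (i, ψ i x) = (i, x) :=
          (congrArg φ e1).symm.trans (h.1 _)
        change ψ i (ψ i x) = x
        rw [inside i (ψ i x) (congrArg Prod.fst e2)] at e2
        exact congrArg Prod.snd e2
      · change ψ i (ψ i x) = x
        rw [outside i x e, outside i x e]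
    · by_cases e : (φ (i, x)).1 = i
      · have e1 := inside i x e
        have := h.2 (i, x) (by
          rw [e1]
          exact fun e' => hx (congrArg Prod.snd e'))
        rw [e1] at this
        rcases this with ⟨-, h2⟩ | ⟨h1, -⟩
        · exact h2
        · exact absurd rfl h1
      · exact absurd (outside i x e) hx
    · refine outside i _ ?_
      rw [hj.2]
      exact hj.1.symm
  refine ⟨(H, ψ), hp, ?_⟩
  funext v
  obtain ⟨i, x⟩ := v
  by_cases e : (φ (i, x)).1 = i
  · refine (glue_of_not (H, ψ) fun j hj hx => ?_).trans (inside i x e).symm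
    subst hx
    rw [hj.2] at e
    exact hj.1 e.symm
  · obtain ⟨j, hj, rfl⟩ := cross i x e
    exact (glue_corner (H, ψ) hj).trans hj.2.symm

theorem glue_corner_self {d n : ℕ}
    (p : SimpleGraph (Fin (d + 1)) × (Fin (d + 1) → Vert d n → Vert d n)) (i : Fin (d + 1)) :
    glue d n p (corner d (n + 1) i) ≠ corner d (n + 1) i ↔
      p.2 i (corner d n i) ≠ corner d n i := by
  have : glue d n p (corner d (n + 1) i) = (i, p.2 i (corner d n i)) :=
    glue_of_not p fun j hj e => hj.ne (corner_injective d n e)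
  rw [this, not_iff_not]
  exact ⟨fun e => congrArg Prod.snd e, fun e => Prod.ext rfl e⟩

open Classical in
/-- The neighbours of a vertex as a finite set. -/
noncomputable def nbrs {V : Type*} [Fintype V] (H : SimpleGraph V) (i : V) : Finset V :=
  {j | H.Adj i j}

theorem mem_nbrs {V : Type*} [Fintype V] {H : SimpleGraph V} {i j : V} :
    j ∈ nbrs H i ↔ H.Adj i j := by
  simp [nbrs]

/-- The number of matchings of a single copy of `TH_d(n)` compatible with the connecting edges and
with the prescribed status of the own outmost vertex of the copy. -/
theorem card_local (d n : ℕ) (H : SimpleGraph (Fin (d + 1))) (S : Finset (Fin (d + 1)))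
    (i : Fin (d + 1)) :
    Nat.card {φ : Vert d n → Vert d n // (IsPairing (TH d n) φ ∧
      ∀ j, H.Adj i j → φ (corner d n j) = corner d n j) ∧
        (φ (corner d n i) ≠ corner d n i ↔ i ∈ S)} =
      binomSum (cornerCount d n) (d - (nbrs H i).card) (if i ∈ S then 1 else 0) := by
  have hi : i ∉ nbrs H i := fun h => (mem_nbrs.1 h).ne rfl
  have hcard : (insert i (nbrs H i)).card ≤ d + 1 := by
    simpa using (insert i (nbrs H i)).card_le_univ
  rw [Finset.card_insert_of_notMem hi] at hcard
  by_cases hS : i ∈ S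
  · have hd : Disjoint (nbrs H i) {i} := Finset.disjoint_singleton_right.2 hi
    have := numPairings_eq_binomSum d n (d - (nbrs H i).card) (nbrs H i) {i} hd
      (by rw [Finset.card_singleton]; omega)
    rw [Finset.card_singleton] at this
    rw [if_pos hS, ← this]
    refine Nat.card_congr (Equiv.subtypeEquivRight fun φ => ?_)
    simp only [mem_nbrs, Finset.mem_singleton, forall_eq, hS, iff_true]
    tauto
  · have hd : Disjoint (insert i (nbrs H i)) ∅ := Finset.disjoint_empty_right _
    have := numPairings_eq_binomSum d n (d - (nbrs H i).card) (insert i (nbrs H i)) ∅ hd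
      (by rw [Finset.card_insert_of_notMem hi, Finset.card_empty]; omega)
    rw [Finset.card_empty] at this
    rw [if_neg hS, ← this]
    refine Nat.card_congr (Equiv.subtypeEquivRight fun φ => ?_)
    simp only [Finset.forall_mem_insert, mem_nbrs, Finset.notMem_empty, hS, iff_false, not_not]
    tauto

/-- One step of the recursion for the numbers of matchings by covered outmost vertices: a sum over
the sets `H` of used connecting edges, with one factor for every copy. The subtraction does not
truncate, see `card_nbrs_le`. -/
noncomputable def step {R : Type*} [CommSemiring R] (d : ℕ) (a : ℕ → R)
    (S : Finset (Fin (d + 1))) : R :=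
  ∑ H : SimpleGraph (Fin (d + 1)),
    ∏ i, binomSum a (d - (nbrs H i).card) (if i ∈ S then 1 else 0)

theorem numWithDimersAt_succ (d n : ℕ) (S : Finset (Fin (d + 1))) :
    numWithDimersAt d (n + 1) S = step d (cornerCount d n) S := by
  unfold numWithDimersAt step
  rw [card_matchings_eq_card_pairings (TH d (n + 1))
    (fun A => ∀ i, corner d (n + 1) i ∈ A ↔ i ∈ (S : Set _))]
  let Q : SimpleGraph (Fin (d + 1)) → (i : Fin (d + 1)) → (Vert d n → Vert d n) → Prop :=
    fun H i φ => (IsPairing (TH d n) φ ∧ ∀ j, H.Adj i j → φ (corner d n j) = corner d n j) ∧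
      (φ (corner d n i) ≠ corner d n i ↔ i ∈ S)
  let e : (Σ H : SimpleGraph (Fin (d + 1)), ∀ i, {φ : Vert d n → Vert d n // Q H i φ}) →
      {φ : Vert d (n + 1) → Vert d (n + 1) // IsPairing (TH d (n + 1)) φ ∧
        ∀ i, corner d (n + 1) i ∈ {x | φ x ≠ x} ↔ i ∈ (S : Set (Fin (d + 1)))} := fun p =>
    ⟨glue d n (p.1, fun i => (p.2 i).1), isPairing_glue fun i => (p.2 i).2.1,
      fun i => (glue_corner_self _ i).trans (p.2 i).2.2⟩
  have he : Function.Bijective e := by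
    constructor
    · rintro ⟨H, ψ⟩ ⟨H', ψ'⟩ h
      have := glue_injective (fun i => (ψ i).2.1) (fun i => (ψ' i).2.1) (congrArg Subtype.val h)
      obtain rfl : H = H' := congrArg Prod.fst this
      obtain rfl : ψ = ψ' := by
        funext i
        exact Subtype.ext (congrFun (congrArg Prod.snd this) i)
      rfl
    · rintro ⟨φ, hφ, hS⟩
      obtain ⟨⟨H, ψ⟩, hp, rfl⟩ := exists_glue_eq hφ
      exact ⟨⟨H, fun i => ⟨ψ i, hp i, (glue_corner_self _ i).symm.trans (hS i)⟩⟩, rfl⟩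
  rw [← Nat.card_congr (Equiv.ofBijective e he), Nat.card_sigma]
  refine Finset.sum_congr rfl fun H _ => ?_
  rw [Nat.card_pi]
  exact Finset.prod_congr rfl fun i _ => card_local d n H S i

/-! ### Sums over sets of connecting edges -/

theorem edgeSet_fromEdgeSet_of_subset {V : Type*} [Fintype V] [DecidableEq V]
    {t : Finset (Sym2 V)} (ht : t ⊆ (⊤ : SimpleGraph V).edgeFinset) :
    (SimpleGraph.fromEdgeSet (t : Set (Sym2 V))).edgeSet = t := by
  rw [SimpleGraph.edgeSet_fromEdgeSet]
  ext e
  refine ⟨fun h => h.1, fun h => ⟨h, ?_⟩⟩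
  have := ht h
  simpa using this

/-- Sums over simple graphs are sums over sets of edges of the complete graph. -/
theorem sum_simpleGraph {V R : Type*} [Fintype V] [DecidableEq V] [AddCommMonoid R]
    (f : SimpleGraph V → R) :
    ∑ H, f H = ∑ t ∈ (⊤ : SimpleGraph V).edgeFinset.powerset,
      f (SimpleGraph.fromEdgeSet (t : Set (Sym2 V))) := by
  obtain ⟨E, hE⟩ : ∃ E : SimpleGraph V → Finset (Sym2 V), ∀ H e, e ∈ E H ↔ e ∈ H.edgeSet :=
    ⟨fun H => H.edgeSet.toFinite.toFinset, fun H e => Set.Finite.mem_toFinset _⟩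
  have hE' : ∀ H, SimpleGraph.fromEdgeSet (E H : Set (Sym2 V)) = H := by
    intro H
    rw [show (E H : Set (Sym2 V)) = H.edgeSet from Set.ext (hE H), SimpleGraph.fromEdgeSet_edgeSet]
  refine Finset.sum_bij' (fun H _ => E H)
    (fun t _ => SimpleGraph.fromEdgeSet (t : Set (Sym2 V))) ?_ ?_ ?_ ?_ ?_
  · intro H _
    refine Finset.mem_powerset.2 fun e he => ?_
    rw [SimpleGraph.mem_edgeFinset]
    exact SimpleGraph.edgeSet_mono le_top ((hE H e).1 he)
  · exact fun t _ => Finset.mem_univ _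
  · intro H _
    exact hE' H
  · intro t ht
    rw [Finset.mem_powerset] at ht
    ext e
    rw [hE, edgeSet_fromEdgeSet_of_subset ht, Finset.mem_coe]
  · intro H _
    rw [hE']

theorem card_nbrs_fromEdgeSet {V : Type*} [Fintype V] [DecidableEq V] {t : Finset (Sym2 V)}
    (ht : t ⊆ (⊤ : SimpleGraph V).edgeFinset) (i : V) :
    (nbrs (SimpleGraph.fromEdgeSet (t : Set (Sym2 V))) i).card =
      (t.filter (fun e => i ∈ e)).card := by
  refine Finset.card_bij (fun j _ => s(i, j)) ?_ ?_ ?_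
  · intro j hj
    rw [mem_nbrs, SimpleGraph.fromEdgeSet_adj] at hj
    exact Finset.mem_filter.2 ⟨hj.1, Sym2.mem_mk_left i j⟩
  · intro j _ k _ h
    exact Sym2.congr_right.1 h
  · intro e he
    obtain ⟨h1, j, rfl⟩ := Finset.mem_filter.1 he
    have := ht h1
    rw [SimpleGraph.mem_edgeFinset, SimpleGraph.mem_edgeSet, SimpleGraph.top_adj] at this
    refine ⟨j, ?_, rfl⟩
    rw [mem_nbrs, SimpleGraph.fromEdgeSet_adj]
    exact ⟨h1, this⟩

theorem card_nbrs_eq_degree {V : Type*} [Fintype V] (H : SimpleGraph V) [DecidableRel H.Adj]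
    (i : V) : (nbrs H i).card = H.degree i := by
  rw [← SimpleGraph.card_neighborFinset_eq_degree]
  congr 1
  ext j
  simp [mem_nbrs]

/-- The handshake lemma. -/
theorem sum_card_nbrs {V : Type*} [Fintype V] [DecidableEq V] {t : Finset (Sym2 V)}
    (ht : t ⊆ (⊤ : SimpleGraph V).edgeFinset) :
    ∑ i, (nbrs (SimpleGraph.fromEdgeSet (t : Set (Sym2 V))) i).card = 2 * t.card := by
  have hE : ∀ (H : SimpleGraph V) [DecidableRel H.Adj],
      (H.edgeSet : Set (Sym2 V)) = t → ∑ i, (nbrs H i).card = 2 * t.card := by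
    intro H _ h
    have h' : H.edgeFinset = t := by
      ext e
      rw [SimpleGraph.mem_edgeFinset, h, Finset.mem_coe]
    rw [← h', ← H.sum_degrees_eq_twice_card_edges]
    exact Finset.sum_congr rfl fun i _ => card_nbrs_eq_degree H i
  classical
  exact hE _ (edgeSet_fromEdgeSet_of_subset ht)

theorem card_nbrs_le {d : ℕ} (H : SimpleGraph (Fin (d + 1))) (i : Fin (d + 1)) :
    (nbrs H i).card ≤ d := by
  classical
  rw [card_nbrs_eq_degree]
  have := H.degree_lt_card_verts i
  rw [Fintype.card_fin] at this
  omega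

/-- If every vertex contributes `x ^ deg * y ^ (d - deg)`, then by the handshake lemma every pair
of vertices contributes `x ^ 2` or `y ^ 2`, independently of the other pairs. -/
theorem sum_prod_pow_degree {R : Type*} [CommSemiring R] (d : ℕ) (x y : R) :
    ∑ H : SimpleGraph (Fin (d + 1)), ∏ i, (x ^ (nbrs H i).card * y ^ (d - (nbrs H i).card)) =
      (x ^ 2 + y ^ 2) ^ ((d + 1).choose 2) := by
  classical
  have hc : (⊤ : SimpleGraph (Fin (d + 1))).edgeFinset.card = (d + 1).choose 2 := by
    rw [SimpleGraph.card_edgeFinset_top_eq_card_choose_two, Fintype.card_fin]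
  rw [← hc, ← Finset.sum_pow_mul_eq_add_pow, sum_simpleGraph]
  refine Finset.sum_congr rfl fun t ht => ?_
  set H := SimpleGraph.fromEdgeSet (t : Set (Sym2 (Fin (d + 1))))
  have htop := Finset.mem_powerset.1 ht
  have h1 : ∑ i, (nbrs H i).card = 2 * t.card := sum_card_nbrs htop
  have h2 : ∑ i, (d - (nbrs H i).card) + ∑ i, (nbrs H i).card = (d + 1) * d := by
    rw [← Finset.sum_add_distrib, Finset.sum_congr rfl fun i _ =>
      Nat.sub_add_cancel (card_nbrs_le H i)]
    simp
  have h3 : 2 * (⊤ : SimpleGraph (Fin (d + 1))).edgeFinset.card = (d + 1) * d := by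
    rw [hc, Nat.choose_two_right, Nat.add_sub_cancel,
      Nat.mul_div_cancel' (by rw [mul_comm]; exact (Nat.even_mul_succ_self d).two_dvd)]
  have h4 := Finset.card_le_card htop
  rw [Finset.prod_mul_distrib, Finset.prod_pow_eq_pow_sum, Finset.prod_pow_eq_pow_sum, h1,
    ← pow_mul, ← pow_mul]
  congr 2
  omega

/-- Evaluation of a sum over all edge sets contained in a list of pairs, the edges being added to
or left out of the degree sequence `δ` one after the other. -/
def edgeSum (φ : Fin 5 → ℕ → ℕ) : List (Fin 5 × Fin 5) → (Fin 5 → ℕ) → ℕ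
  | [], δ => φ 0 (δ 0) * φ 1 (δ 1) * φ 2 (δ 2) * φ 3 (δ 3) * φ 4 (δ 4)
  | e :: l, δ => edgeSum φ l δ +
      edgeSum φ l (fun i => δ i + if i = e.1 ∨ i = e.2 then 1 else 0)

theorem edgeSum_eq (φ : Fin 5 → ℕ → ℕ) : ∀ (l : List (Fin 5 × Fin 5)) (δ : Fin 5 → ℕ),
    (l.map fun p => s(p.1, p.2)).Nodup →
      edgeSum φ l δ = ∑ t ∈ (l.map fun p => s(p.1, p.2)).toFinset.powerset,
        ∏ i, φ i (δ i + (t.filter (fun e => i ∈ e)).card)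
  | [], δ, _ => by
    simp [edgeSum, Fin.prod_univ_five]
  | e :: l, δ, h => by
    rw [List.map_cons, List.nodup_cons] at h
    rw [edgeSum, edgeSum_eq φ l _ h.2, edgeSum_eq φ l _ h.2, List.map_cons, List.toFinset_cons,
      Finset.sum_powerset_insert (by rw [List.mem_toFinset]; exact h.1)]
    congr 1
    refine Finset.sum_congr rfl fun t ht => Finset.prod_congr rfl fun i _ => ?_
    have hn : s(e.1, e.2) ∉ t := fun h' =>
      h.1 (List.mem_toFinset.1 (Finset.mem_powerset.1 ht h'))
    rw [Finset.filter_insert]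
    by_cases hi : i = e.1 ∨ i = e.2
    · rw [if_pos hi, if_pos (Sym2.mem_iff.2 hi)]
      rw [Finset.card_insert_of_notMem fun h' => hn (Finset.mem_filter.1 h').1]
      congr 1
      ring
    · rw [if_neg hi, if_neg fun h' => hi (Sym2.mem_iff.1 h'), add_zero]

/-- The pairs of distinct elements of `Fin 5`. -/
def edgeList : List (Fin 5 × Fin 5) :=
  [(0, 1), (0, 2), (0, 3), (0, 4), (1, 2), (1, 3), (1, 4), (2, 3), (2, 4), (3, 4)]

theorem step_eq_edgeSum (a : ℕ → ℕ) (S : Finset (Fin 5)) :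
    step 4 a S =
      edgeSum (fun i δ => binomSum a (4 - δ) (if i ∈ S then 1 else 0)) edgeList (fun _ => 0) := by
  have h1 : (edgeList.map fun p => s(p.1, p.2)).Nodup := by decide
  have h2 : (edgeList.map fun p => s(p.1, p.2)).toFinset =
      (⊤ : SimpleGraph (Fin 5)).edgeFinset := by decide +kernel
  rw [edgeSum_eq _ _ _ h1, h2, step, sum_simpleGraph]
  refine Finset.sum_congr rfl fun t ht => Finset.prod_congr rfl fun i _ => ?_
  rw [card_nbrs_fromEdgeSet (Finset.mem_powerset.1 ht), zero_add]

/-! ### Numerical values of the recursion -/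

theorem binomSum_congr {R : Type*} [Add R] {a b : ℕ → R} (r : ℕ) : ∀ k,
    (∀ j ≤ k + r, a j = b j) → binomSum a r k = binomSum b r k := by
  induction r with
  | zero => exact fun k h => h k le_rfl
  | succ r ih =>
    intro k h
    rw [binomSum, binomSum, ih k fun j hj => h j (by omega), ih (k + 1) fun j hj => h j (by omega)]

theorem step_congr {R : Type*} [CommSemiring R] {d : ℕ} {a b : ℕ → R}
    (h : ∀ j ≤ d + 1, a j = b j) (S : Finset (Fin (d + 1))) : step d a S = step d b S := by
  refine Finset.sum_congr rfl fun H _ => Finset.prod_congr rfl fun i _ => ?_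
  refine binomSum_congr _ _ fun j hj => h j (hj.trans ?_)
  split_ifs <;> omega

theorem map_binomSum {R R' : Type*} [CommSemiring R] [CommSemiring R'] (f : R →+* R') (a : ℕ → R)
    (r : ℕ) : ∀ k, f (binomSum a r k) = binomSum (fun j => f (a j)) r k := by
  induction r with
  | zero => exact fun k => rfl
  | succ r ih =>
    intro k
    rw [binomSum, binomSum, map_add, ih, ih]

theorem map_step {R R' : Type*} [CommSemiring R] [CommSemiring R'] (f : R →+* R') (d : ℕ)
    (a : ℕ → R) (S : Finset (Fin (d + 1))) :
    f (step d a S) = step d (fun j => f (a j)) S := by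
  rw [step, step, map_sum]
  refine Finset.sum_congr rfl fun H _ => ?_
  rw [map_prod]
  exact Finset.prod_congr rfl fun i _ => map_binomSum f a _ _

theorem cornerCount_succ (d n k : ℕ) : cornerCount d (n + 1) k =
    step d (cornerCount d n) ({i : Fin (d + 1) | (i : ℕ) < k} : Finset (Fin (d + 1))) :=
  numWithDimersAt_succ d n _

/-- The complete graph on five vertices has `1`, `1` and `3` matchings covering exactly a given
set of `0`, `2` and `4` vertices. -/
theorem cornerCount_zero {k : ℕ} (hk : k ≤ 5) :
    cornerCount 4 0 k = [1, 0, 1, 0, 3, 0].getD k 0 := by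
  have key : ∀ m : Fin 6, Fintype.card {φ : Fin 5 → Fin 5 //
      ((∀ x, φ (φ x) = x) ∧ ∀ x, φ x ≠ x → x ≠ φ x) ∧
        ∀ i, φ i ≠ i ↔ i ∈ ({i : Fin 5 | (i : ℕ) < m} : Finset (Fin 5))} =
      [1, 0, 1, 0, 3, 0].getD (m : ℕ) 0 := by
    decide +kernel
  rw [← key ⟨k, by omega⟩, ← Nat.card_eq_fintype_card, cornerCount, numWithDimersAt,
    card_matchings_eq_card_pairings (TH 4 0) (fun A => ∀ i, corner 4 0 i ∈ A ↔
      i ∈ (({i : Fin 5 | (i : ℕ) < k} : Finset (Fin 5)) : Set (Fin 5)))]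
  rfl

theorem step_getD_eq_edgeSum (L : List ℕ) (k : ℕ) :
    step 4 (fun j => L.getD j 0) ({i : Fin 5 | (i : ℕ) < k} : Finset (Fin 5)) =
      edgeSum (fun i δ => binomSum (fun j => L.getD j 0) (4 - δ)
        (if (i : ℕ) < k then 1 else 0)) edgeList (fun _ => 0) := by
  rw [step_eq_edgeSum]
  simp only [Finset.mem_filter, Finset.mem_univ, true_and]

theorem cornerCount_one {k : ℕ} (hk : k ≤ 5) :
    cornerCount 4 1 k = [510980, 755968, 1123642, 1677248, 2513329, 3779500].getD k 0 := by
  have key : ∀ m : Fin 6, edgeSum (fun i δ => binomSum (fun j => [1, 0, 1, 0, 3, 0].getD j 0)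
      (4 - δ) (if (i : ℕ) < m then 1 else 0)) edgeList (fun _ => 0) =
        [510980, 755968, 1123642, 1677248, 2513329, 3779500].getD (m : ℕ) 0 := by
    decide +kernel
  rw [cornerCount_succ, step_congr fun j hj => cornerCount_zero hj, step_getD_eq_edgeSum]
  exact key ⟨k, by omega⟩

/-- The recursion carries residues modulo `3` to residues modulo `3`. -/
theorem cornerCount_succ_mod_three {n : ℕ} {L L' : List ℕ}
    (h : ∀ k ≤ 5, cornerCount 4 n k ≡ L.getD k 0 [MOD 3])
    (key : ∀ m : Fin 6, edgeSum (fun i δ => binomSum (fun j => L.getD j 0) (4 - δ)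
      (if (i : ℕ) < m then 1 else 0)) edgeList (fun _ => 0) ≡ L'.getD (m : ℕ) 0 [MOD 3]) :
    ∀ k ≤ 5, cornerCount 4 (n + 1) k ≡ L'.getD k 0 [MOD 3] := by
  intro k hk
  refine Nat.ModEq.trans ?_ (key ⟨k, by omega⟩)
  rw [← ZMod.natCast_eq_natCast_iff, ← step_getD_eq_edgeSum, cornerCount_succ]
  have hm := fun a => map_step (Nat.castRingHom (ZMod 3)) 4 a
    ({i : Fin 5 | (i : ℕ) < k} : Finset (Fin 5))
  refine (hm _).trans (Eq.trans (step_congr (fun j hj => ?_) _) (hm _).symm)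
  exact (ZMod.natCast_eq_natCast_iff _ _ _).2 (h j hj)

/-- From stage `1` on, the numbers of matchings modulo `3` take only two patterns. This serves to
show that they never form a geometric sequence. -/
theorem cornerCount_mod_three (n : ℕ) :
    (∀ k ≤ 5, cornerCount 4 (n + 1) k ≡ [2, 1, 1, 2, 1, 1].getD k 0 [MOD 3]) ∨
      ∀ k ≤ 5, cornerCount 4 (n + 1) k ≡ [1, 2, 2, 1, 2, 2].getD k 0 [MOD 3] := by
  induction n with
  | zero =>
    left
    intro k hk
    rw [cornerCount_one hk]
    have : ∀ m : Fin 6, [510980, 755968, 1123642, 1677248, 2513329, 3779500].getD (m : ℕ) 0 ≡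
      [2, 1, 1, 2, 1, 1].getD (m : ℕ) 0 [MOD 3] := by decide
    exact this ⟨k, by omega⟩
  | succ n ih =>
    rcases ih with ih | ih
    · exact Or.inr (cornerCount_succ_mod_three ih (by decide +kernel))
    · exact Or.inl (cornerCount_succ_mod_three ih (by decide +kernel))

/-! ### Log-convex sequences -/

/-- The sequence `a 0, …, a N` is positive and log-convex. -/
structure LogConvexUpTo (N : ℕ) (a : ℕ → ℝ) : Prop where
  pos : ∀ k ≤ N, 0 < a k
  sq_le : ∀ k, k + 2 ≤ N → a (k + 1) ^ 2 ≤ a k * a (k + 2)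

/-- The quotients `a i / a (i + 1)` are antitone. -/
theorem LogConvexUpTo.mul_le_mul_succ {N : ℕ} {a : ℕ → ℝ} (h : LogConvexUpTo N a) {i j : ℕ}
    (hij : i ≤ j) (hj : j + 1 ≤ N) : a (i + 1) * a j ≤ a i * a (j + 1) := by
  induction j, hij using Nat.le_induction with
  | base => exact (mul_comm _ _).le
  | succ j hij ih =>
    have h1 := ih (by omega)
    have h2 := h.sq_le j hj
    have h0 := h.pos j (by omega)
    have h3 := h.pos i (by omega)
    have h4 := h.pos (j + 1) (by omega)
    refine le_of_mul_le_mul_left ?_ h0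
    calc a j * (a (i + 1) * a (j + 1)) = a (i + 1) * a j * a (j + 1) := by ring
      _ ≤ a i * a (j + 1) * a (j + 1) := by gcongr
      _ = a i * a (j + 1) ^ 2 := by ring
      _ ≤ a i * (a j * a (j + 2)) := by gcongr
      _ = a j * (a i * a (j + 1 + 1)) := by ring

/-- Spreading two indices apart with their sum fixed increases the product. -/
theorem LogConvexUpTo.mul_le_mul {N : ℕ} {a : ℕ → ℝ} (h : LogConvexUpTo N a) {lo hi x y : ℕ}
    (hx : lo ≤ x) (hy : lo ≤ y) (hs : x + y = lo + hi) (hN : hi ≤ N) :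
    a x * a y ≤ a lo * a hi := by
  obtain ⟨t, rfl⟩ := Nat.exists_eq_add_of_le hx
  obtain rfl : hi = y + t := by omega
  clear hx hs
  induction t generalizing lo with
  | zero => exact le_rfl
  | succ t ih =>
    by_cases hlt : lo < y
    · have h1 := ih (lo := lo + 1) hlt (by omega)
      have h2 := h.mul_le_mul_succ (i := lo) (j := y + t) (by omega) (by omega)
      rw [show lo + (t + 1) = lo + 1 + t by ring]
      exact h1.trans h2
    · obtain rfl : lo = y := by omega
      rw [mul_comm]

theorem binomSum_pos {N : ℕ} {a : ℕ → ℝ} (h : ∀ k ≤ N, 0 < a k) (r : ℕ) :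
    ∀ k, k + r ≤ N → 0 < binomSum a r k := by
  induction r with
  | zero => exact fun k hk => h k hk
  | succ r ih => exact fun k hk => add_pos (ih k (by omega)) (ih (k + 1) (by omega))

theorem LogConvexUpTo.binomSum_arg_right {N r : ℕ} {a : ℕ → ℝ} (h : LogConvexUpTo (N + r) a) :
    LogConvexUpTo N (binomSum a r) := by
  induction r generalizing N with
  | zero => exact h
  | succ r ih =>
    have hb : LogConvexUpTo (N + 1) (binomSum a r) :=
      ih (by rwa [add_assoc, add_comm 1 r])
    refine ⟨fun k hk => add_pos (hb.pos k (by omega)) (hb.pos (k + 1) (by omega)), fun k hk => ?_⟩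
    have h1 := hb.sq_le k (by omega)
    have h2 := hb.sq_le (k + 1) (by omega)
    have h3 := hb.mul_le_mul_succ (i := k) (j := k + 2) (by omega) (by omega)
    simp only [binomSum]
    simp only [add_assoc, Nat.reduceAdd] at h1 h2 h3 ⊢
    linarith

/-- Log-convexity in the number of free outmost vertices. -/
theorem LogConvexUpTo.binomSum_arg_left {N k : ℕ} {a : ℕ → ℝ} (h : LogConvexUpTo (N + k) a) :
    LogConvexUpTo N (fun r => binomSum a r k) := by
  refine ⟨fun r hr => binomSum_pos h.pos r k (by omega), fun r hr => ?_⟩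
  have hb : LogConvexUpTo (k + 2) (binomSum a r) :=
    LogConvexUpTo.binomSum_arg_right
        ⟨fun j hj => h.pos j (by omega), fun j hj => h.sq_le j (by omega)⟩
  have := hb.sq_le k le_rfl
  simp only [binomSum]
  simp only [add_assoc, Nat.reduceAdd] at this ⊢
  linarith

/-- The more outmost vertices are left free, the smaller is the quotient of the numbers of
matchings that leave a further outmost vertex uncovered and of those that cover it. -/
theorem LogConvexUpTo.binomSum_ratio {N r s : ℕ} {a : ℕ → ℝ} (h : LogConvexUpTo N a)
    (hrs : r ≤ s) (hs : s + 1 ≤ N) :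
    binomSum a s 0 * binomSum a r 1 ≤
      binomSum a r 0 * binomSum a s 1 := by
  induction s, hrs using Nat.le_induction with
  | base => exact le_rfl
  | succ s hrs ih =>
    have h1 := ih (by omega)
    have hb : LogConvexUpTo 2 (binomSum a s) :=
      LogConvexUpTo.binomSum_arg_right
        ⟨fun j hj => h.pos j (by omega), fun j hj => h.sq_le j (by omega)⟩
    have h2 := hb.sq_le 0 le_rfl
    have p0 := hb.pos 0 (by omega)
    have p1 := hb.pos 1 (by omega)
    have q0 := binomSum_pos h.pos r 0 (by omega)
    have q1 := binomSum_pos h.pos r 1 (by omega)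
    rw [binomSum, binomSum]
    simp only [zero_add, Nat.reduceAdd] at h2 ⊢
    set x0 := binomSum a s 0
    set x1 := binomSum a s 1
    set x2 := binomSum a s 2
    set y0 := binomSum a r 0
    set y1 := binomSum a r 1
    have h3 : x1 * y1 ≤ y0 * x2 := by
      refine le_of_mul_le_mul_left ?_ p0
      calc x0 * (x1 * y1) = x1 * (x0 * y1) := by ring
        _ ≤ x1 * (y0 * x1) := by gcongr
        _ = y0 * x1 ^ 2 := by ring
        _ ≤ y0 * (x0 * x2) := by gcongr
        _ = x0 * (y0 * x2) := by ring
    linarith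

/-- The local inequality behind the preservation of log-convexity, in the case of a copy whose own
outmost vertex is uncovered on one side and covered on the other. -/
theorem LogConvexUpTo.binomSum_cross {d r s x y : ℕ} {a : ℕ → ℝ} (h : LogConvexUpTo (d + 1) a)
    (hx : r ≤ x) (hy : r ≤ y) (he : x + y = r + s) (hs : s ≤ d) :
    binomSum a x 0 * binomSum a y 1 ≤
      binomSum a s 1 * binomSum a r 0 := by
  have h1 := h.binomSum_ratio hx (by omega)
  have h2 := (h.binomSum_arg_left (k := 1)).mul_le_mul hx hy he hs
  have pr := binomSum_pos h.pos r 1 (by omega)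
  have py := binomSum_pos h.pos y 1 (by omega)
  have p0 := binomSum_pos h.pos r 0 (by omega)
  refine le_of_mul_le_mul_left ?_ pr
  set F := binomSum a
  calc F r 1 * (F x 0 * F y 1) = F x 0 * F r 1 * F y 1 := by ring
    _ ≤ F r 0 * F x 1 * F y 1 := by gcongr
    _ = F r 0 * (F x 1 * F y 1) := by ring
    _ ≤ F r 0 * (F r 1 * F s 1) := by gcongr
    _ = F r 1 * (F s 1 * F r 0) := by ring

/-! ### The correlation inequality -/

theorem nbrs_inf {V : Type*} [Fintype V] [DecidableEq V] (A B : SimpleGraph V) (i : V) :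
    nbrs (A ⊓ B) i = nbrs A i ∩ nbrs B i := by
  ext j
  simp [mem_nbrs]

theorem nbrs_sup {V : Type*} [Fintype V] [DecidableEq V] (A B : SimpleGraph V) (i : V) :
    nbrs (A ⊔ B) i = nbrs A i ∪ nbrs B i := by
  ext j
  simp [mem_nbrs]

theorem step_factor_pos {d : ℕ} {a : ℕ → ℝ} (h : LogConvexUpTo (d + 1) a)
    (H : SimpleGraph (Fin (d + 1))) (S : Finset (Fin (d + 1))) (i : Fin (d + 1)) :
    0 < binomSum a (d - (nbrs H i).card) (if i ∈ S then 1 else 0) := by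
  refine binomSum_pos h.pos _ _ ?_
  split_ifs <;> omega

/-- Correlation inequality: the events that two given outmost vertices are uncovered are
positively correlated at the next stage. Degrees are modular on the lattice of sets of connecting
edges, so that log-convexity yields the lattice condition of the four functions theorem factor by
factor. -/
theorem step_erase_mul_step_erase_le {d : ℕ} {a : ℕ → ℝ} (h : LogConvexUpTo (d + 1) a)
    {S : Finset (Fin (d + 1))} {p q : Fin (d + 1)} (hp : p ∈ S) (hq : q ∈ S) (hpq : p ≠ q) :
    step d a (S.erase p) * step d a (S.erase q) ≤ step d a S * step d a ((S.erase p).erase q) := by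
  classical
  have hnn : ∀ T : Finset (Fin (d + 1)), (0 : SimpleGraph (Fin (d + 1)) → ℝ) ≤ fun H =>
      ∏ i, binomSum a (d - (nbrs H i).card) (if i ∈ T then 1 else 0) :=
    fun T H => Finset.prod_nonneg fun i _ => (step_factor_pos h H T i).le
  refine four_functions_theorem_univ _ _ _ _ (hnn _) (hnn _) (hnn _) (hnn _) fun A B => ?_
  rw [← Finset.prod_mul_distrib, ← Finset.prod_mul_distrib]
  refine Finset.prod_le_prod
    (fun i _ => mul_nonneg (step_factor_pos h A _ i).le (step_factor_pos h B _ i).le) fun i _ => ?_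
  have hsum := Finset.card_inter_add_card_union (nbrs A i) (nbrs B i)
  have hl1 := Finset.card_le_card (Finset.subset_union_left (s₁ := nbrs A i) (s₂ := nbrs B i))
  have hl2 := Finset.card_le_card (Finset.subset_union_right (s₁ := nbrs A i) (s₂ := nbrs B i))
  rw [← nbrs_inf, ← nbrs_sup] at hsum
  rw [← nbrs_sup] at hl1 hl2
  have hA := card_nbrs_le A i
  have hB := card_nbrs_le B i
  have hU := card_nbrs_le (A ⊔ B) i
  have hx : d - (nbrs (A ⊔ B) i).card ≤ d - (nbrs A i).card := by omega
  have hy : d - (nbrs (A ⊔ B) i).card ≤ d - (nbrs B i).card := by omega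
  have he : d - (nbrs A i).card + (d - (nbrs B i).card) =
    d - (nbrs (A ⊔ B) i).card + (d - (nbrs (A ⊓ B) i).card) := by omega
  have hs : d - (nbrs (A ⊓ B) i).card ≤ d := Nat.sub_le _ _
  by_cases hip : i = p
  -- at `p` and at `q` either side has one factor for the uncovered and one for the covered vertex
  · subst hip
    simp only [Finset.mem_erase, ne_eq, not_true_eq_false, false_and, and_false, if_false, hp,
      hpq, not_false_eq_true, and_self, if_true]
    exact h.binomSum_cross hx hy he hs
  · by_cases hiq : i = q
    · subst hiq
      simp only [Finset.mem_erase, ne_eq, not_true_eq_false, false_and, if_false, hq,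
        hip, not_false_eq_true, and_self, if_true]
      rw [mul_comm]
      exact h.binomSum_cross hy hx ((add_comm _ _).trans he) hs
    · simp only [Finset.mem_erase, ne_eq, hip, hiq, not_false_eq_true, true_and]
      rw [mul_comm (binomSum a (d - (nbrs (A ⊓ B) i).card) _)]
      have hc : LogConvexUpTo (d + if i ∈ S then 1 else 0) a := by
        split_ifs
        · exact h
        · exact ⟨fun k hk => h.pos k (by omega), fun k hk => h.sq_le k (by omega)⟩
      exact hc.binomSum_arg_left.mul_le_mul hx hy he hs

/-! ### Comparison with geometric sequences -/

theorem binomSum_le_mul_succ {N : ℕ} {a : ℕ → ℝ} {α : ℝ}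
    (h : ∀ k, k + 1 ≤ N → a k ≤ α * a (k + 1))
    (r : ℕ) : ∀ k, k + 1 + r ≤ N → binomSum a r k ≤ α * binomSum a r (k + 1) := by
  induction r with
  | zero => exact fun k hk => h k hk
  | succ r ih =>
    intro k hk
    rw [binomSum, binomSum, mul_add]
    exact add_le_add (ih k (by omega)) (ih (k + 1) (by omega))

theorem mul_succ_le_binomSum {N : ℕ} {a : ℕ → ℝ} {α : ℝ}
    (h : ∀ k, k + 1 ≤ N → α * a (k + 1) ≤ a k)
    (r : ℕ) : ∀ k, k + 1 + r ≤ N → α * binomSum a r (k + 1) ≤ binomSum a r k := by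
  induction r with
  | zero => exact fun k hk => h k hk
  | succ r ih =>
    intro k hk
    rw [binomSum, binomSum, mul_add]
    exact add_le_add (ih k (by omega)) (ih (k + 1) (by omega))

theorem step_erase_le {d : ℕ} {a : ℕ → ℝ} (ha : LogConvexUpTo (d + 1) a) {α : ℝ}
    (h : ∀ k, k + 1 ≤ d + 1 → a k ≤ α * a (k + 1)) {S : Finset (Fin (d + 1))} {p : Fin (d + 1)}
    (hp : p ∈ S) : step d a (S.erase p) ≤ α * step d a S := by
  rw [step, step, Finset.mul_sum]
  refine Finset.sum_le_sum fun H _ => ?_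
  rw [← Finset.mul_prod_erase _ _ (Finset.mem_univ p),
    ← Finset.mul_prod_erase _ _ (Finset.mem_univ p), ← mul_assoc, if_neg (Finset.notMem_erase p S),
    if_pos hp]
  have e : ∀ i ∈ Finset.univ.erase p, binomSum a (d - (nbrs H i).card)
      (if i ∈ S.erase p then 1 else 0) =
        binomSum a (d - (nbrs H i).card) (if i ∈ S then 1 else 0) := by
    intro i hi
    simp only [Finset.mem_erase, Finset.ne_of_mem_erase hi, ne_eq, not_false_eq_true, true_and]
  rw [Finset.prod_congr rfl e]
  refine mul_le_mul_of_nonneg_right ?_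
    (Finset.prod_nonneg fun i _ => (step_factor_pos ha H S i).le)
  exact binomSum_le_mul_succ h _ 0 (by omega)

theorem le_step_erase {d : ℕ} {a : ℕ → ℝ} (ha : LogConvexUpTo (d + 1) a) {α : ℝ}
    (h : ∀ k, k + 1 ≤ d + 1 → α * a (k + 1) ≤ a k) {S : Finset (Fin (d + 1))} {p : Fin (d + 1)}
    (hp : p ∈ S) : α * step d a S ≤ step d a (S.erase p) := by
  rw [step, step, Finset.mul_sum]
  refine Finset.sum_le_sum fun H _ => ?_
  rw [← Finset.mul_prod_erase _ _ (Finset.mem_univ p),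
    ← Finset.mul_prod_erase _ _ (Finset.mem_univ p), ← mul_assoc, if_neg (Finset.notMem_erase p S),
    if_pos hp]
  have e : ∀ i ∈ Finset.univ.erase p, binomSum a (d - (nbrs H i).card)
      (if i ∈ S.erase p then 1 else 0) =
        binomSum a (d - (nbrs H i).card) (if i ∈ S then 1 else 0) := by
    intro i hi
    simp only [Finset.mem_erase, Finset.ne_of_mem_erase hi, ne_eq, not_false_eq_true, true_and]
  rw [Finset.prod_congr rfl e]
  refine mul_le_mul_of_nonneg_right ?_
    (Finset.prod_nonneg fun i _ => (step_factor_pos ha H S i).le)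
  exact mul_succ_le_binomSum h _ 0 (by omega)

theorem binomSum_le {N : ℕ} {a : ℕ → ℝ} {α : ℝ} (hα : 0 ≤ α)
    (h : ∀ k, k + 1 ≤ N → a k ≤ α * a (k + 1)) (r : ℕ) : ∀ k, k + r ≤ N →
      binomSum a r k ≤ α ^ (N - k - r) * (1 + α) ^ r * a N := by
  induction r with
  | zero =>
    intro k hk
    have key : ∀ t, ∀ k, k + t = N → a k ≤ α ^ t * a N := by
      intro t
      induction t with
      | zero =>
        rintro k rfl
        simp
      | succ t ih =>
        intro k hk
        calc a k ≤ α * a (k + 1) := h k (by omega)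
          _ ≤ α * (α ^ t * a N) := mul_le_mul_of_nonneg_left (ih (k + 1) (by omega)) hα
          _ = α ^ (t + 1) * a N := by ring
    simpa [binomSum] using key (N - k) k (by omega)
  | succ r ih =>
    intro k hk
    have h1 := ih k (by omega)
    have h2 := ih (k + 1) (by omega)
    rw [show N - k - r = N - k - (r + 1) + 1 by omega] at h1
    rw [show N - (k + 1) - r = N - k - (r + 1) by omega] at h2
    refine (add_le_add h1 h2).trans_eq ?_
    ring

theorem le_binomSum {N : ℕ} {a : ℕ → ℝ} {α : ℝ} (hα : 0 ≤ α)
    (h : ∀ k, k + 1 ≤ N → α * a (k + 1) ≤ a k) (r : ℕ) : ∀ k, k + r ≤ N →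
      α ^ (N - k - r) * (1 + α) ^ r * a N ≤ binomSum a r k := by
  induction r with
  | zero =>
    intro k hk
    have key : ∀ t, ∀ k, k + t = N → α ^ t * a N ≤ a k := by
      intro t
      induction t with
      | zero =>
        rintro k rfl
        simp
      | succ t ih =>
        intro k hk
        calc α ^ (t + 1) * a N = α * (α ^ t * a N) := by ring
          _ ≤ α * a (k + 1) := mul_le_mul_of_nonneg_left (ih (k + 1) (by omega)) hα
          _ ≤ a k := h k (by omega)
    simpa [binomSum] using key (N - k) k (by omega)
  | succ r ih =>
    intro k hk
    have h1 := ih k (by omega)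
    have h2 := ih (k + 1) (by omega)
    rw [show N - k - r = N - k - (r + 1) + 1 by omega] at h1
    rw [show N - (k + 1) - r = N - k - (r + 1) by omega] at h2
    refine Eq.trans_le ?_ (add_le_add h1 h2)
    ring

/-- The value of the recursion for a geometric sequence. -/
theorem sum_prod_geometric (d : ℕ) (α u : ℝ) :
    ∑ H : SimpleGraph (Fin (d + 1)), ∏ i,
        (α ^ (nbrs H i).card * (1 + α) ^ (d - (nbrs H i).card) * u) =
      u ^ (d + 1) * (1 + 2 * α + 2 * α ^ 2) ^ ((d + 1).choose 2) := by
  rw [show 1 + 2 * α + 2 * α ^ 2 = α ^ 2 + (1 + α) ^ 2 by ring, ← sum_prod_pow_degree,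
    Finset.mul_sum]
  refine Finset.sum_congr rfl fun H _ => ?_
  rw [Finset.prod_mul_distrib, Finset.prod_const, Finset.card_univ, Fintype.card_fin, mul_comm]

/-- The empty set of connecting edges has a term with a strict inequality, hence `hlt` suffices. -/
theorem step_univ_lt {d : ℕ} {a : ℕ → ℝ} (ha : LogConvexUpTo (d + 1) a) {α : ℝ} (hα : 0 ≤ α)
    (h : ∀ k, k + 1 ≤ d + 1 → a k ≤ α * a (k + 1))
    (hlt : binomSum a d 1 < (1 + α) ^ d * a (d + 1)) :
    step d a Finset.univ < a (d + 1) ^ (d + 1) * (1 + 2 * α + 2 * α ^ 2) ^ ((d + 1).choose 2) := by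
  rw [← sum_prod_geometric, step]
  have hle : ∀ (H : SimpleGraph (Fin (d + 1))) i, binomSum a (d - (nbrs H i).card)
      (if i ∈ (Finset.univ : Finset (Fin (d + 1))) then 1 else 0) ≤
        α ^ (nbrs H i).card * (1 + α) ^ (d - (nbrs H i).card) * a (d + 1) := by
    intro H i
    rw [if_pos (Finset.mem_univ i)]
    have := binomSum_le hα h (d - (nbrs H i).card) 1 (by omega)
    rwa [show d + 1 - 1 - (d - (nbrs H i).card) = (nbrs H i).card by
      have := card_nbrs_le H i
      omega] at this
  refine Finset.sum_lt_sum (fun H _ => Finset.prod_le_prod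
    (fun i _ => (step_factor_pos ha H _ i).le) fun i _ => hle H i) ⟨⊥, Finset.mem_univ _, ?_⟩
  refine Finset.prod_lt_prod_of_nonempty (fun i _ => step_factor_pos ha ⊥ _ i) (fun i _ => ?_)
    Finset.univ_nonempty
  have h0 : (nbrs (⊥ : SimpleGraph (Fin (d + 1))) i).card = 0 := by
    rw [Finset.card_eq_zero, Finset.eq_empty_iff_forall_notMem]
    exact fun j hj => (mem_nbrs.1 hj).elim
  simpa [h0] using hlt

theorem lt_step_univ {d : ℕ} {a : ℕ → ℝ} (ha : LogConvexUpTo (d + 1) a) {α : ℝ} (hα : 0 ≤ α)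
    (h : ∀ k, k + 1 ≤ d + 1 → α * a (k + 1) ≤ a k)
    (hlt : (1 + α) ^ d * a (d + 1) < binomSum a d 1) :
    a (d + 1) ^ (d + 1) * (1 + 2 * α + 2 * α ^ 2) ^ ((d + 1).choose 2) < step d a Finset.univ := by
  rw [← sum_prod_geometric, step]
  have hu := ha.pos (d + 1) le_rfl
  have hle : ∀ (H : SimpleGraph (Fin (d + 1))) i,
      α ^ (nbrs H i).card * (1 + α) ^ (d - (nbrs H i).card) * a (d + 1) ≤
      binomSum a (d - (nbrs H i).card)
        (if i ∈ (Finset.univ : Finset (Fin (d + 1))) then 1 else 0) := by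
    intro H i
    rw [if_pos (Finset.mem_univ i)]
    have := le_binomSum hα h (d - (nbrs H i).card) 1 (by omega)
    rwa [show d + 1 - 1 - (d - (nbrs H i).card) = (nbrs H i).card by
      have := card_nbrs_le H i
      omega] at this
  refine Finset.sum_lt_sum (fun H _ => Finset.prod_le_prod
    (fun i _ => by positivity) fun i _ => hle H i) ⟨⊥, Finset.mem_univ _, ?_⟩
  have h0 : ∀ i, (nbrs (⊥ : SimpleGraph (Fin (d + 1))) i).card = 0 := by
    intro i
    rw [Finset.card_eq_zero, Finset.eq_empty_iff_forall_notMem]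
    exact fun j hj => (mem_nbrs.1 hj).elim
  refine Finset.prod_lt_prod_of_nonempty (fun i _ => ?_) (fun i _ => ?_) Finset.univ_nonempty
  · rw [h0]
    positivity
  · simpa [h0] using hlt

/-! ### Log-convexity of the numbers of matchings -/

theorem cornerCount_succ_cast (d n : ℕ) (S : Finset (Fin (d + 1))) :
    (cornerCount d (n + 1) S.card : ℝ) = step d (fun k => (cornerCount d n k : ℝ)) S := by
  rw [← numWithDimersAt_eq_cornerCount, numWithDimersAt_succ]
  exact map_step (Nat.castRingHom ℝ) d _ S

theorem exists_finset_card {d k : ℕ} (hk : k ≤ d + 1) :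
    ∃ S : Finset (Fin (d + 1)), S.card = k := by
  obtain ⟨S, -, hS⟩ := Finset.exists_subset_card_eq (s := (Finset.univ : Finset (Fin (d + 1))))
    (by simpa using hk)
  exact ⟨S, hS⟩

/-- Log-convexity of the numbers of matchings, by covered outmost vertices, passes from one stage
to the next. -/
theorem LogConvexUpTo.cornerCount_succ {d n : ℕ}
    (h : LogConvexUpTo (d + 1) (fun k => (cornerCount d n k : ℝ))) :
    LogConvexUpTo (d + 1) (fun k => (cornerCount d (n + 1) k : ℝ)) := by
  refine ⟨fun k hk => ?_, fun k hk => ?_⟩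
  · obtain ⟨S, rfl⟩ := exists_finset_card hk
    rw [cornerCount_succ_cast]
    exact Finset.sum_pos (fun H _ => Finset.prod_pos fun i _ => step_factor_pos h H S i)
      Finset.univ_nonempty
  · obtain ⟨S, hS⟩ := exists_finset_card hk
    obtain ⟨p, q, hp, hq, hpq⟩ := Finset.one_lt_card_iff.1 (show 1 < S.card by omega)
    have h1 := step_erase_mul_step_erase_le h hp hq hpq
    rw [← cornerCount_succ_cast, ← cornerCount_succ_cast, ← cornerCount_succ_cast,
      ← cornerCount_succ_cast, Finset.card_erase_of_mem (Finset.mem_erase.2 ⟨hpq.symm, hq⟩),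
      Finset.card_erase_of_mem hp, Finset.card_erase_of_mem hq, hS] at h1
    simp only [Nat.add_sub_cancel, Nat.reduceSubDiff] at h1
    rw [sq, mul_comm (cornerCount d (n + 1) k : ℝ)]
    exact h1

theorem logConvexUpTo_cornerCount {n : ℕ} (hn : 1 ≤ n) :
    LogConvexUpTo 5 (fun k => (cornerCount 4 n k : ℝ)) := by
  induction n, hn using Nat.le_induction with
  | base =>
    refine ⟨fun k hk => ?_, fun k hk => ?_⟩
    · have : ∀ m : Fin 6, 0 < [510980, 755968, 1123642, 1677248, 2513329, 3779500].getD (m : ℕ) 0 :=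
        by decide
      rw [cornerCount_one hk]
      exact_mod_cast this ⟨k, by omega⟩
    · rw [cornerCount_one (by omega), cornerCount_one (by omega), cornerCount_one (by omega)]
      have hk' : k ≤ 3 := by omega
      interval_cases k <;> norm_num
  | succ n _ ih => exact ih.cornerCount_succ

/-- In both patterns modulo `3`, the two sides have different residues. -/
theorem cornerCount_mul_ne_sq (n : ℕ) :
    cornerCount 4 (n + 1) 1 * cornerCount 4 (n + 1) 3 ≠ cornerCount 4 (n + 1) 2 ^ 2 := by
  intro e
  rcases cornerCount_mod_three n with h | h <;>
  · have h1 := (h 1 (by norm_num)).mul (h 3 (by norm_num))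
    have h2 := (h 2 (by norm_num)).pow 2
    rw [e] at h1
    exact absurd (h1.symm.trans h2) (by decide)

theorem u₄_eq (n : ℕ) : u₄ n = cornerCount 4 n 5 := by
  rw [u₄, ← Finset.coe_univ, numWithDimersAt_eq_cornerCount]
  rfl

theorem f₄_eq (n : ℕ) : f₄ n = cornerCount 4 n 0 := by
  rw [f₄, ← Finset.coe_empty, numWithDimersAt_eq_cornerCount]
  rfl

theorem g₄_eq (n : ℕ) : g₄ n = cornerCount 4 n 1 := by
  rw [g₄, ← Finset.coe_singleton, numWithDimersAt_eq_cornerCount]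
  rfl

theorem s₄_eq (n : ℕ) : s₄ n = cornerCount 4 n 4 := by
  rw [s₄, ← Finset.coe_singleton, ← Finset.coe_compl, numWithDimersAt_eq_cornerCount]
  rfl

/-! ### Bounds for the recursion -/

section Ratios

variable {n : ℕ}

theorem u₄_pos (hn : 1 ≤ n) : 0 < u₄ n := by
  rw [u₄_eq]
  exact_mod_cast (logConvexUpTo_cornerCount hn).pos 5 le_rfl

theorem g₄_pos (hn : 1 ≤ n) : 0 < g₄ n := by
  rw [g₄_eq]
  exact_mod_cast (logConvexUpTo_cornerCount hn).pos 1 (by norm_num)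

theorem ω₄_pos (hn : 1 ≤ n) : 0 < ω₄ n := by
  rw [ω₄, s₄_eq, u₄_eq]
  have h := logConvexUpTo_cornerCount hn
  exact div_pos (h.pos 4 (by norm_num)) (h.pos 5 le_rfl)

theorem α₄_pos (hn : 1 ≤ n) : 0 < α₄ n := by
  rw [α₄, f₄_eq, g₄_eq]
  have h := logConvexUpTo_cornerCount hn
  exact div_pos (h.pos 0 (by norm_num)) (h.pos 1 (by norm_num))

theorem cornerCount_le_α₄_mul (hn : 1 ≤ n) (k : ℕ) (hk : k + 1 ≤ 4 + 1) :
    (cornerCount 4 n k : ℝ) ≤ α₄ n * cornerCount 4 n (k + 1) := by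
  have h := logConvexUpTo_cornerCount hn
  rw [α₄, f₄_eq, g₄_eq, div_mul_eq_mul_div, le_div_iff₀ (h.pos 1 (by norm_num)), mul_comm]
  exact h.mul_le_mul_succ (i := 0) (Nat.zero_le k) hk

theorem ω₄_mul_le_cornerCount (hn : 1 ≤ n) (k : ℕ) (hk : k + 1 ≤ 4 + 1) :
    ω₄ n * cornerCount 4 n (k + 1) ≤ (cornerCount 4 n k : ℝ) := by
  have h := logConvexUpTo_cornerCount hn
  rw [ω₄, s₄_eq, u₄_eq, div_mul_eq_mul_div, div_le_iff₀ (h.pos 5 le_rfl), mul_comm]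
  exact h.mul_le_mul_succ (j := 4) (by omega) le_rfl

/-- The bound by `α₄ n` holds for all quotients at stage `n`, and the recursion passes it on. -/
theorem α₄_succ_le (hn : 1 ≤ n) : α₄ (n + 1) ≤ α₄ n := by
  have h := logConvexUpTo_cornerCount (n := n + 1) (by omega)
  have := step_erase_le (logConvexUpTo_cornerCount hn) (cornerCount_le_α₄_mul hn)
    (Finset.mem_singleton_self (0 : Fin 5))
  rw [← cornerCount_succ_cast, ← cornerCount_succ_cast] at this
  rw [α₄, f₄_eq, g₄_eq, div_le_iff₀ (h.pos 1 (by norm_num))]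
  simpa using this

theorem ω₄_le_succ (hn : 1 ≤ n) : ω₄ n ≤ ω₄ (n + 1) := by
  have h := logConvexUpTo_cornerCount (n := n + 1) (by omega)
  have := le_step_erase (logConvexUpTo_cornerCount hn) (ω₄_mul_le_cornerCount hn)
    (Finset.mem_univ (0 : Fin 5))
  rw [← cornerCount_succ_cast, ← cornerCount_succ_cast] at this
  change _ ≤ (s₄ (n + 1) : ℝ) / u₄ (n + 1)
  rw [s₄_eq, u₄_eq, le_div_iff₀ (h.pos 5 le_rfl)]
  simpa using this

/-- Log-convexity is strict at one place, hence the quotients are not all equal. -/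
theorem sq_lt_mul (hn : 1 ≤ n) :
    (cornerCount 4 n 2 : ℝ) ^ 2 < cornerCount 4 n 1 * cornerCount 4 n 3 := by
  refine lt_of_le_of_ne ((logConvexUpTo_cornerCount hn).sq_le 1 (by norm_num)) ?_
  obtain ⟨m, rfl⟩ := Nat.exists_eq_add_of_le' hn
  exact_mod_cast (cornerCount_mul_ne_sq m).symm

theorem u₄_succ_lt (hn : 1 ≤ n) :
    (u₄ (n + 1) : ℝ) < u₄ n ^ 5 * (1 + 2 * α₄ n + 2 * α₄ n ^ 2) ^ 10 := by
  have h := logConvexUpTo_cornerCount hn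
  have hα := α₄_pos hn
  have key := step_univ_lt h hα.le (cornerCount_le_α₄_mul hn)
  rw [← cornerCount_succ_cast] at key
  rw [u₄_eq, u₄_eq]
  refine key ?_
  have h1 := cornerCount_le_α₄_mul hn 1 (by norm_num)
  have h2 := cornerCount_le_α₄_mul hn 2 (by norm_num)
  have h3 := cornerCount_le_α₄_mul hn 3 (by norm_num)
  have h4 := cornerCount_le_α₄_mul hn 4 (by norm_num)
  have hs := sq_lt_mul hn
  have p2 := h.pos 2 (by norm_num)
  have p3 := h.pos 3 (by norm_num)
  simp only [binomSum, Nat.reduceAdd] at *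
  generalize (cornerCount 4 n 1 : ℝ) = a1 at *
  generalize (cornerCount 4 n 2 : ℝ) = a2 at *
  generalize (cornerCount 4 n 3 : ℝ) = a3 at *
  generalize (cornerCount 4 n 4 : ℝ) = a4 at *
  generalize (cornerCount 4 n 5 : ℝ) = a5 at *
  generalize α₄ n = α at *
  have b3 : a3 ≤ α ^ 2 * a5 := by
    calc a3 ≤ α * a4 := h3
      _ ≤ α * (α * a5) := by gcongr
      _ = α ^ 2 * a5 := by ring
  have b2 : a2 < α ^ 3 * a5 := by
    have : a2 < α * a3 := by
      refine lt_of_mul_lt_mul_left ?_ p2.le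
      calc a2 * a2 = a2 ^ 2 := by ring
        _ < a1 * a3 := hs
        _ ≤ α * a2 * a3 := by gcongr
        _ = a2 * (α * a3) := by ring
    calc a2 < α * a3 := this
      _ ≤ α * (α ^ 2 * a5) := by gcongr
      _ = α ^ 3 * a5 := by ring
  have b1 : a1 ≤ α ^ 4 * a5 := by
    calc a1 ≤ α * a2 := h1
      _ ≤ α * (α ^ 3 * a5) := by gcongr
      _ = α ^ 4 * a5 := by ring
  linarith

theorem lt_u₄_succ (hn : 1 ≤ n) :
    (u₄ n : ℝ) ^ 5 * (1 + 2 * ω₄ n + 2 * ω₄ n ^ 2) ^ 10 < u₄ (n + 1) := by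
  have h := logConvexUpTo_cornerCount hn
  have hω := ω₄_pos hn
  have key := lt_step_univ h hω.le (ω₄_mul_le_cornerCount hn)
  rw [← cornerCount_succ_cast] at key
  rw [u₄_eq, u₄_eq]
  refine key ?_
  have h1 := ω₄_mul_le_cornerCount hn 1 (by norm_num)
  have h2 := ω₄_mul_le_cornerCount hn 2 (by norm_num)
  have h3 := ω₄_mul_le_cornerCount hn 3 (by norm_num)
  have h4 := ω₄_mul_le_cornerCount hn 4 (by norm_num)
  have hs := sq_lt_mul hn
  have p2 := h.pos 2 (by norm_num)
  have p3 := h.pos 3 (by norm_num)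
  simp only [binomSum, Nat.reduceAdd] at *
  generalize (cornerCount 4 n 1 : ℝ) = a1 at *
  generalize (cornerCount 4 n 2 : ℝ) = a2 at *
  generalize (cornerCount 4 n 3 : ℝ) = a3 at *
  generalize (cornerCount 4 n 4 : ℝ) = a4 at *
  generalize (cornerCount 4 n 5 : ℝ) = a5 at *
  generalize ω₄ n = ω at *
  have b3 : ω ^ 2 * a5 ≤ a3 := by
    calc ω ^ 2 * a5 = ω * (ω * a5) := by ring
      _ ≤ ω * a4 := by gcongr
      _ ≤ a3 := h3
  have b2 : ω ^ 3 * a5 ≤ a2 := by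
    calc ω ^ 3 * a5 = ω * (ω ^ 2 * a5) := by ring
      _ ≤ ω * a3 := by gcongr
      _ ≤ a2 := h2
  have b1 : ω ^ 4 * a5 < a1 := by
    have : ω * a2 < a1 := by
      refine lt_of_mul_lt_mul_right ?_ p3.le
      calc ω * a2 * a3 = a2 * (ω * a3) := by ring
        _ ≤ a2 * a2 := by gcongr
        _ = a2 ^ 2 := by ring
        _ < a1 * a3 := hs
    calc ω ^ 4 * a5 = ω * (ω ^ 3 * a5) := by ring
      _ ≤ ω * a2 := by gcongr
      _ < a1 := this
  linarith

theorem numDimerMonomers_eq_binomSum (n : ℕ) :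
    numDimerMonomers (TH 4 n) = binomSum (cornerCount 4 n) 5 0 := by
  rw [numDimerMonomers_eq, numPairings_eq_binomSum 4 n 5 ∅ ∅ (Finset.disjoint_empty_left _) rfl]
  rfl

theorem u₄_le_numDimerMonomers (n : ℕ) : (u₄ n : ℝ) ≤ numDimerMonomers (TH 4 n) := by
  have h : u₄ n ≤ numDimerMonomers (TH 4 n) := by
    rw [u₄_eq, numDimerMonomers_eq_binomSum]
    simp only [binomSum, Nat.reduceAdd]
    omega
  exact_mod_cast h

theorem numDimerMonomers_le (hn : 1 ≤ n) :
    (numDimerMonomers (TH 4 n) : ℝ) ≤ (1 + α₄ n) ^ 5 * u₄ n := by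
  have h := binomSum_le (α₄_pos hn).le (cornerCount_le_α₄_mul hn) 5 0 le_rfl
  rw [numDimerMonomers_eq_binomSum, u₄_eq]
  refine (Eq.trans_le ?_ h).trans_eq ?_
  · exact map_binomSum (Nat.castRingHom ℝ) _ 5 0
  · simp

end Ratios

/-! ### The entropy per site -/

/-- The lower or upper bound of the entropy per site obtained from stage `n` when the numbers of
matchings are replaced by a geometric sequence with quotient `x`. -/
noncomputable def entropyBound (x : ℝ) (n : ℕ) : ℝ :=
  Real.log (u₄ n) / 5 ^ (n + 1) + Real.log (1 + 2 * x + 2 * x ^ 2) / (2 * 5 ^ n)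

theorem log_pow_mul_pow {u q : ℝ} (hu : 0 < u) (hq : 0 < q) :
    Real.log (u ^ 5 * q ^ 10) = 5 * Real.log u + 10 * Real.log q := by
  rw [Real.log_mul (by positivity) (by positivity), Real.log_pow, Real.log_pow]
  norm_num

/-- The second summand of the bound is exactly what is gained from stage `n` on if every
stage gains `10 * log (1 + 2 * x + 2 * x ^ 2)`. -/
theorem entropyBound_telescope (x : ℝ) (n : ℕ) :
    (5 * Real.log (u₄ n) + 10 * Real.log (1 + 2 * x + 2 * x ^ 2)) / 5 ^ (n + 1 + 1) +
      Real.log (1 + 2 * x + 2 * x ^ 2) / (2 * 5 ^ (n + 1)) = entropyBound x n := by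
  rw [entropyBound]
  field_simp
  ring

theorem entropyBound_lt_succ {n : ℕ} (hn : 1 ≤ n) {x : ℝ} (hx : 0 ≤ x) (hxn : x ≤ ω₄ n) :
    entropyBound x n < entropyBound x (n + 1) := by
  have hu : (0 : ℝ) < u₄ n := by exact_mod_cast u₄_pos hn
  have hq : 0 < 1 + 2 * x + 2 * x ^ 2 := by positivity
  have h : (u₄ n : ℝ) ^ 5 * (1 + 2 * x + 2 * x ^ 2) ^ 10 < u₄ (n + 1) :=
    lt_of_le_of_lt (by gcongr) (lt_u₄_succ hn)
  have hlog := Real.log_lt_log (by positivity) h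
  rw [log_pow_mul_pow hu hq] at hlog
  rw [← entropyBound_telescope, entropyBound]
  gcongr

theorem entropyBound_succ_lt {n : ℕ} (hn : 1 ≤ n) {x : ℝ} (hxn : α₄ n ≤ x) :
    entropyBound x (n + 1) < entropyBound x n := by
  have hu : (0 : ℝ) < u₄ n := by exact_mod_cast u₄_pos hn
  have hu' : (0 : ℝ) < u₄ (n + 1) := by exact_mod_cast u₄_pos (Nat.le_add_left 1 n)
  have hα := α₄_pos hn
  have hx : 0 < x := hα.trans_le hxn
  have hq : 0 < 1 + 2 * x + 2 * x ^ 2 := by positivity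
  have h : (u₄ (n + 1) : ℝ) < u₄ n ^ 5 * (1 + 2 * x + 2 * x ^ 2) ^ 10 :=
    lt_of_lt_of_le (u₄_succ_lt hn) (by gcongr)
  have hlog := Real.log_lt_log hu' h
  rw [log_pow_mul_pow hu hq] at hlog
  rw [← entropyBound_telescope x n, entropyBound]
  gcongr

theorem ω₄_mono {m n : ℕ} (hm : 1 ≤ m) (h : m ≤ n) : ω₄ m ≤ ω₄ n := by
  induction n, h using Nat.le_induction with
  | base => exact le_rfl
  | succ n hmn ih => exact ih.trans (ω₄_le_succ (hm.trans hmn))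

theorem α₄_anti {m n : ℕ} (hm : 1 ≤ m) (h : m ≤ n) : α₄ n ≤ α₄ m := by
  induction n, h using Nat.le_induction with
  | base => exact le_rfl
  | succ n hmn ih => exact (α₄_succ_le (hm.trans hmn)).trans ih

theorem strictMono_entropyBound {k : ℕ} (hk : 1 ≤ k) :
    StrictMono fun n => entropyBound (ω₄ k) (n + k) :=
  strictMono_nat_of_lt_succ fun n => by
    have := entropyBound_lt_succ (n := n + k) (by omega) (ω₄_pos hk).le (ω₄_mono hk (by omega))
    rwa [show n + k + 1 = n + 1 + k by ring] at this

theorem strictAnti_entropyBound {k : ℕ} (hk : 1 ≤ k) :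
    StrictAnti fun n => entropyBound (α₄ k) (n + k) :=
  strictAnti_nat_of_succ_lt fun n => by
    have := entropyBound_succ_lt (n := n + k) (by omega) (α₄_anti hk (Nat.le_add_left k n))
    rwa [show n + k + 1 = n + 1 + k by ring] at this

theorem tendsto_const_div_pow (c : ℝ) : Tendsto (fun n : ℕ => c / (5 : ℝ) ^ n) atTop (𝓝 0) :=
  tendsto_const_nhds.div_atTop (tendsto_pow_atTop_atTop_of_one_lt (by norm_num))

theorem tendsto_entropyBound_sub (x : ℝ) :
    Tendsto (fun n => entropyBound x n - Real.log (u₄ n) / 5 ^ (n + 1)) atTop (𝓝 0) := by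
  refine (tendsto_const_div_pow (Real.log (1 + 2 * x + 2 * x ^ 2) / 2)).congr fun n => ?_
  rw [entropyBound, add_sub_cancel_left, div_div]

theorem ω₄_le_α₄ {n : ℕ} (hn : 1 ≤ n) : ω₄ n ≤ α₄ n := by
  have hu : (0 : ℝ) < cornerCount 4 n 1 := (logConvexUpTo_cornerCount hn).pos 1 (by norm_num)
  exact le_of_mul_le_mul_right ((ω₄_mul_le_cornerCount hn 0 (by norm_num)).trans
    (cornerCount_le_α₄_mul hn 0 (by norm_num))) hu

theorem entropyBound_mono {x y : ℝ} (hx : 0 ≤ x) (hxy : x ≤ y) (n : ℕ) :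
    entropyBound x n ≤ entropyBound y n := by
  have hq : 0 < 1 + 2 * x + 2 * x ^ 2 := by positivity
  unfold entropyBound
  gcongr

theorem exists_tendsto_log_u₄ :
    ∃ z : ℝ, Tendsto (fun n => Real.log (u₄ n) / 5 ^ (n + 1)) atTop (𝓝 z) := by
  have hmono := (strictMono_entropyBound le_rfl).monotone
  have hbdd : BddAbove (Set.range fun n => entropyBound (ω₄ 1) (n + 1)) := by
    refine ⟨entropyBound (α₄ 1) 1, ?_⟩
    rintro _ ⟨n, rfl⟩
    have h1 := (strictAnti_entropyBound le_rfl).antitone (Nat.zero_le n)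
    simp only [zero_add] at h1
    exact (entropyBound_mono (ω₄_pos le_rfl).le (ω₄_le_α₄ le_rfl) _).trans h1
  have h := (tendsto_add_atTop_iff_nat 1).1 (tendsto_atTop_ciSup hmono hbdd)
  exact ⟨_, by simpa using h.sub (tendsto_entropyBound_sub (ω₄ 1))⟩

/-- The matchings that cover all outmost vertices determine the entropy per site. -/
theorem isEntropyPerSite_of_tendsto {z : ℝ}
    (h : Tendsto (fun n => Real.log (u₄ n) / 5 ^ (n + 1)) atTop (𝓝 z)) : IsEntropyPerSite 4 z := by
  have hup : Tendsto (fun n : ℕ => Real.log (u₄ n) / 5 ^ (n + 1) +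
      Real.log (1 + α₄ 1) / 5 ^ n) atTop (𝓝 z) := by
    simpa using h.add (tendsto_const_div_pow (Real.log (1 + α₄ 1)))
  refine tendsto_of_tendsto_of_tendsto_of_le_of_le' h hup ?_ ?_
  · filter_upwards [eventually_ge_atTop 1] with n hn
    have hu : (0 : ℝ) < u₄ n := by exact_mod_cast u₄_pos hn
    have hN := u₄_le_numDimerMonomers n
    rw [card_vert]
    push_cast
    gcongr
  · filter_upwards [eventually_ge_atTop 1] with n hn
    have hu : (0 : ℝ) < u₄ n := by exact_mod_cast u₄_pos hn
    have hα := α₄_pos hn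
    have hα1 := α₄_anti le_rfl hn
    have hN : (0 : ℝ) < numDimerMonomers (TH 4 n) := hu.trans_le (u₄_le_numDimerMonomers n)
    have hle : (numDimerMonomers (TH 4 n) : ℝ) ≤ (1 + α₄ 1) ^ 5 * u₄ n :=
      (numDimerMonomers_le hn).trans (by gcongr)
    have hlog := Real.log_le_log hN hle
    have hα1' := α₄_pos le_rfl
    rw [Real.log_mul (by positivity) (by positivity), Real.log_pow] at hlog
    rw [card_vert]
    calc Real.log (numDimerMonomers (TH 4 n)) / ((4 + 1) ^ (n + 1) : ℕ)
        ≤ ((5 : ℕ) * Real.log (1 + α₄ 1) + Real.log (u₄ n)) / ((4 + 1) ^ (n + 1) : ℕ) := by gcongr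
      _ = Real.log (u₄ n) / 5 ^ (n + 1) + Real.log (1 + α₄ 1) / 5 ^ n := by
        push_cast
        field_simp
        ring

end TowerOfHanoi

theorem mainTheorem7 :
    ∃ z : ℝ, TowerOfHanoi.IsEntropyPerSite 4 z ∧
      ∀ k : ℕ, 1 ≤ k →
        0 < TowerOfHanoi.u₄ k ∧ 0 < TowerOfHanoi.g₄ k ∧
        Real.log (TowerOfHanoi.u₄ k : ℝ) / 5 ^ (k + 1)
            + Real.log (1 + 2 * TowerOfHanoi.ω₄ k + 2 * TowerOfHanoi.ω₄ k ^ 2) / (2 * 5 ^ k) < z ∧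
        z < Real.log (TowerOfHanoi.u₄ k : ℝ) / 5 ^ (k + 1)
            + Real.log (1 + 2 * TowerOfHanoi.α₄ k + 2 * TowerOfHanoi.α₄ k ^ 2) / (2 * 5 ^ k) := by
  obtain ⟨z, hz⟩ := TowerOfHanoi.exists_tendsto_log_u₄
  refine ⟨z, TowerOfHanoi.isEntropyPerSite_of_tendsto hz, fun k hk =>
    ⟨TowerOfHanoi.u₄_pos hk, TowerOfHanoi.g₄_pos hk, ?_, ?_⟩⟩
  all_goals
    have ht : ∀ x, Tendsto (fun n => TowerOfHanoi.entropyBound x (n + k)) atTop (𝓝 z) := by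
      intro x
      refine (tendsto_add_atTop_iff_nat k).2 ?_
      simpa using (TowerOfHanoi.tendsto_entropyBound_sub x).add hz
  · have hm := TowerOfHanoi.strictMono_entropyBound hk
    have h1 := hm zero_lt_one
    simp only [zero_add] at h1
    exact h1.trans_le (hm.monotone.ge_of_tendsto (ht _) 1)
  · have hm := TowerOfHanoi.strictAnti_entropyBound hk
    have h1 := hm zero_lt_one
    simp only [zero_add] at h1
    exact (hm.antitone.le_of_tendsto (ht _) 1).trans_lt h1
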